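/- For a finitely generated group $G$ with word length $|\cdot|_G$ (for some finite generating set) and a real Banach space $\mathfrak X$, a map $\Psi:G\to\mathfrak X$ is called equivariant if $\Psi(g)=\tau(g)v$ for all $g\in G$, for some action $\tau$ of $G$ on $\mathfrak X$ by affine isometries and some $v\in\mathfrak X$. Put $\rho_\Psi(t)=\inf\{\|\Psi(x)-\Psi(y)\|:\ x,y\in G,\ |x^{-1}y|_G\ge t\}$ and $\alpha_{\mathfrak X}(\Psi)=\sup\{\alpha\ge 0:\ \exists c>0\text{ such that }\rho_\Psi(t)\ge ct^\alpha\text{ for all }t\ge1\}$, with $\sup\emptyset=0$. The equivariant compression exponent $\alpha^{\#}_{\mathfrak X}(G)$ is the supremum of $\alpha_{\mathfrak X}(\Psi)$ over all Lipschitz equivariant maps $\Psi:G\to\mathfrak X$; it does not depend on the finite generating set. Write $\alpha_p^{\#}(G)$ when $\mathfrak X=L_p([0,1])$ with Lebesgue measure. The wreath product $H\wr\mathbb Z$ is the set of pairs $(f,i)$ with $f:\mathbb Z\to H$ finitely supported and $i\in\mathbb Z$, with the product $(f,i)(g,j)=(f(\cdot)\,g(\cdot-i),\,i+j)$; it is finitely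 generated when $H$ is. **Theorem.** Let $p\in[1,2]$ and let $H$ be a finitely generated infinite group. Then $$\alpha_p^{\#}(H\wr\mathbb Z)=\min\left\{\frac{\alpha_p^{\#}(H)}{\alpha_p^{\#}(H)+\left(1-\frac1p\right)},\ \alpha_p^{\#}(H)\right\},$$ where the fraction is read as $0$ if $p=1$ and $\alpha_p^{\#}(H)=0$. -/

import Mathlib

open scoped ENNReal NNReal

noncomputable section

/-- The wreath product `H ≀ ℤ = H^{(ℤ)} ⋊ ℤ`: pairs `(f, i)` of a finitely supported lamp
configuration `f : ℤ → H` and a cursor position `i : ℤ`. -/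
@[ext]
structure WreathZ (H : Type*) [Group H] where
  /-- the lamp configuration -/
  lamp : ℤ → H
  /-- the position of the cursor -/
  pos : ℤ
  finite_support : (Function.mulSupport lamp).Finite

namespace WreathZ

variable {H : Type*} [Group H]

/-- The product rule `(f, i) (g, j) = (f(·) g(· - i), i + j)`. -/
instance : Mul (WreathZ H) where
  mul a b :=
    { lamp := fun x => a.lamp x * b.lamp (x - a.pos)
      pos := a.pos + b.pos
      finite_support :=
        (a.finite_support.union (b.finite_support.preimage
          (f := fun x : ℤ => x - a.pos) (sub_left_injective.injOn))).subset
          (Function.mulSupport_mul _ _) }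

instance : One (WreathZ H) where
  one := { lamp := fun _ => 1, pos := 0, finite_support := by simp }

instance : Inv (WreathZ H) where
  inv a :=
    { lamp := fun x => (a.lamp (x + a.pos))⁻¹
      pos := -a.pos
      finite_support := by
        refine (a.finite_support.preimage
          (f := fun x : ℤ => x + a.pos) (add_left_injective a.pos).injOn).subset ?_
        intro x hx
        simpa [Function.mem_mulSupport] using hx }

@[simp] theorem lamp_mul (a b : WreathZ H) (x : ℤ) :
    (a * b).lamp x = a.lamp x * b.lamp (x - a.pos) := rfl

@[simp] theorem pos_mul (a b : WreathZ H) : (a * b).pos = a.pos + b.pos := rfl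

@[simp] theorem lamp_one (x : ℤ) : (1 : WreathZ H).lamp x = 1 := rfl

@[simp] theorem pos_one : (1 : WreathZ H).pos = 0 := rfl

@[simp] theorem lamp_inv (a : WreathZ H) (x : ℤ) :
    (a⁻¹).lamp x = (a.lamp (x + a.pos))⁻¹ := rfl

@[simp] theorem pos_inv (a : WreathZ H) : (a⁻¹).pos = -a.pos := rfl

instance : Group (WreathZ H) where
  mul_assoc a b c := by
    ext x
    · simp [mul_assoc, sub_sub]
    · simp [add_assoc]
  one_mul a := by ext x <;> simp
  mul_one a := by ext x <;> simp
  inv_mul_cancel a := by ext x <;> simp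

end WreathZ

namespace Compression

variable {G : Type*} [Group G]

/-- The word length of `g` with respect to `S`: the least length of a word in the letters
`S ∪ S⁻¹` that represents `g` (such words exist for every `g` when `S` generates `G`). -/
def wordLength (S : Set G) (g : G) : ℕ :=
  sInf {n : ℕ | ∃ l : List G, l.length = n ∧ (∀ s ∈ l, s ∈ S ∨ s⁻¹ ∈ S) ∧ l.prod = g}

variable {X : Type*} [NormedAddCommGroup X]

/-- `Ψ` is Lipschitz for the word metric `d(x, y) = |x⁻¹ y|`. -/
def IsWordLipschitz (S : Set G) (Ψ : G → X) : Prop :=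
  ∃ L : ℝ, ∀ x y : G, ‖Ψ x - Ψ y‖ ≤ L * wordLength S (x⁻¹ * y)

/-- `Ψ` is `G`-equivariant: it is an orbit map `g ↦ τ(g) v` of an action `τ` of `G` on `X` by
affine isometries. -/
def IsEquivariant [NormedSpace ℝ X] (Ψ : G → X) : Prop :=
  ∃ (τ : G →* (X ≃ᵃⁱ[ℝ] X)) (v : X), ∀ g : G, Ψ g = τ g v

/-- The compression function `ρ_Ψ(t) = inf {‖Ψ(x) - Ψ(y)‖ : |x⁻¹ y| ≥ t}`, an infimum
in `[0, ∞]`. -/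
def compression (S : Set G) (Ψ : G → X) (t : ℝ) : ℝ≥0∞ :=
  ⨅ (x : G) (y : G) (_ : t ≤ (wordLength S (x⁻¹ * y) : ℝ)), ENNReal.ofReal ‖Ψ x - Ψ y‖

/-- The compression exponent of a map,
`α(Ψ) = sup {α ≥ 0 : ∃ c > 0, ρ_Ψ(t) ≥ c t ^ α for all t ≥ 1}`, a supremum in `[0, ∞]`. -/
def compressionExponent (S : Set G) (Ψ : G → X) : ℝ≥0∞ :=
  ⨆ (α : ℝ≥0) (_ : ∃ c : ℝ, 0 < c ∧
    ∀ t : ℝ, 1 ≤ t → ENNReal.ofReal (c * t ^ (α : ℝ)) ≤ compression S Ψ t), (α : ℝ≥0∞)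

/-- The equivariant compression exponent of `G` (with finite generating set `S`) in the Banach
space `X`: the supremum of `α(Ψ)` over the Lipschitz `G`-equivariant maps `Ψ : G → X`. -/
def equivariantExponent (S : Set G) (X : Type*) [NormedAddCommGroup X] [NormedSpace ℝ X] :
    ℝ≥0∞ :=
  ⨆ (Ψ : G → X) (_ : IsWordLipschitz S Ψ) (_ : IsEquivariant Ψ), compressionExponent S Ψ

/-- The equivariant `L_p`-compression exponent `α_p^#(G)`, where `L_p = L_p([0,1])` is the real
Lebesgue space. -/
def equivariantLpExponent (p : ℝ≥0∞) [Fact (1 ≤ p)] (S : Set G) : ℝ≥0∞ :=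
  equivariantExponent S
    (MeasureTheory.Lp ℝ p (MeasureTheory.volume.restrict (Set.Icc (0 : ℝ) 1)))

end Compression

end

/-! The displacement `N g = ‖Ψ g - Ψ 1‖` of an equivariant map `Ψ` is symmetric and subadditive, so
`Ψ` is automatically Lipschitz and the equivariant compression exponent is the supremum of the
*admissible* `β`: those for which some equivariant `Ψ` satisfies `c |g| ^ β ≤ N g` for all `g ≠ 1`
(`equivariantExponent_eq`). The word length of `(f, i)` in `H ≀ ℤ` is `|i|`, plus the range of `f`,
plus `∑ |f x|`, up to constants; `exists_wordLength_le` and `exists_lampLength_le` are the bounds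
that are needed. Write `r` for the real number `p`, and let `α`, `β` be exponents for `H` and
`H ≀ ℤ`.

*Upper bound.* The lamp group `H` is undistorted, so an exponent of `H ≀ ℤ` is one of `H`
(`Admissible.of_wreath`). For the fraction, the obstruction is a Poincaré inequality for functions
of a cursor `i` and bits `f` on an interval of length `m = 2 ^ K` (`lamplighter_poincare`):
inverting all the bits costs at most the flips of the bit `x` seen from the cursor at `x`, plus an
energy in the cursor variable. The function is decomposed into martingale differences over the bits,
and each difference is compared with its value at the cursor position of its own bit by a one-point
Poincaré inequality on the interval (`sum_sq_le_energy`): the sum of the squares of a function is at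
most `2 m` times its square at any given point plus an energy with kernel `m / (i - j) ^ 2`, up to
powers of `K`. For `0 < r < 2`, `|s| ^ r` is an integral of `1 - cos (u s)` over `u`, so an
inequality between sums of squared differences of real functions passes to `r`-th powers of
distances in `L_p`, `p ≤ 2` (`sum_Lp_norm_rpow_nonneg`).

If `p = 1` the fraction is `1` or `0` and gives nothing new. If `p > 1` and `H` does not admit `α`,
there are elements `h` with `|h| = n` large and `N h ≤ n ^ α` in the lamp at `0`. Let the bits
choose between `1` and `h` in `m` lamps. On average over the configurations, the `r`-th power of the
distance from a configuration to the one with all bits inverted is then at most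
`m (n ^ α) ^ r + m ^ r`, up to constants and powers of `log m`, while their word distance is at least `m n`, up to a
constant. Balancing with `m ≈ n ^ (α r / (r - 1))` gives `β (α + 1 - 1 / r) ≤ α`
(`Admissible.mul_le_of_not_admissible`).

*Lower bound.* Countable `ℓ_p` sums of copies of `L_p([0,1])` are isometric to `L_p([0,1])`, since
the unit interval splits into countably many scaled copies of itself (`nonempty_lp_Lp_equiv`). This
makes room for three equivariant maps: the cursor; the lamps, whose displacement is the `ℓ_p` sum of
the displacements of the `f x`; and the farthest lit lamp (`exists_isEquivariant_range`), on either
side by reflection. The last comes from a vector on the cosets of the subgroup of elements with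
cursor `0` and no lamp lit at a position `x > 0`. It is supported on the ray of the cosets of the
shifts by `x ≥ 0`, with weights `(x + 1) ^ (s - 1 / p)`: moving the cursor translates the ray and
changes the vector by a `p`-summable amount exactly because `s < 1`, whereas lighting a lamp at `z`
moves the part of the ray below `z` off itself and costs `z ^ s`. If `D` is the total displacement,
then `f` has range at most `D ^ (1 / s)` and `∑ |f x| ^ (α r) ≤ D ^ r` up to constants, and Hölder's
inequality bounds `∑ |f x|` by `D ^ (1 / β)` as soon as `β ≤ α` and `β (α + 1 - 1 / r) < α`
(`Admissible.wreath`). -/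

/-! ### Word length and admissible exponents -/

namespace Compression

section WordLength

variable {G : Type*} [Group G] {S : Set G}

theorem wordLength_le_of_list (l : List G) (hl : ∀ s ∈ l, s ∈ S ∨ s⁻¹ ∈ S) :
    wordLength S l.prod ≤ l.length :=
  Nat.sInf_le ⟨l, rfl, hl, rfl⟩

theorem exists_word (hS : Subgroup.closure S = ⊤) (g : G) :
    ∃ l : List G, l.length = wordLength S g ∧ (∀ s ∈ l, s ∈ S ∨ s⁻¹ ∈ S) ∧ l.prod = g := by
  refine Nat.sInf_mem (s := {n : ℕ | ∃ l : List G, l.length = n ∧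
    (∀ s ∈ l, s ∈ S ∨ s⁻¹ ∈ S) ∧ l.prod = g}) ?_
  have hg : g ∈ Submonoid.closure (S ∪ S⁻¹) := by
    rw [← Subgroup.closure_toSubmonoid, hS]
    trivial
  obtain ⟨l, hl, rfl⟩ := Submonoid.exists_list_of_mem_closure hg
  exact ⟨l.length, l, rfl, hl, rfl⟩

theorem wordLength_one : wordLength S (1 : G) = 0 :=
  Nat.le_zero.1 (wordLength_le_of_list (S := S) [] (by simp))

theorem wordLength_mul_le (hS : Subgroup.closure S = ⊤) (g h : G) :
    wordLength S (g * h) ≤ wordLength S g + wordLength S h := by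
  obtain ⟨l, hl, hl', rfl⟩ := exists_word hS g
  obtain ⟨k, hk, hk', rfl⟩ := exists_word hS h
  rw [← List.prod_append, ← hl, ← hk, ← List.length_append]
  refine wordLength_le_of_list _ fun s hs => ?_
  rcases List.mem_append.1 hs with h | h
  exacts [hl' s h, hk' s h]

theorem wordLength_inv_le (hS : Subgroup.closure S = ⊤) (g : G) :
    wordLength S g⁻¹ ≤ wordLength S g := by
  obtain ⟨l, hl, hl', rfl⟩ := exists_word hS g
  rw [List.prod_inv_reverse, ← hl]
  refine (wordLength_le_of_list _ fun s hs => ?_).trans (by simp)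
  simp only [List.mem_reverse, List.mem_map] at hs
  obtain ⟨a, ha, rfl⟩ := hs
  rw [inv_inv]
  exact (hl' a ha).symm

theorem wordLength_inv (hS : Subgroup.closure S = ⊤) (g : G) :
    wordLength S g⁻¹ = wordLength S g :=
  le_antisymm (wordLength_inv_le hS g) (by simpa using wordLength_inv_le hS g⁻¹)

theorem eq_one_of_wordLength_eq_zero (hS : Subgroup.closure S = ⊤) {g : G}
    (h : wordLength S g = 0) : g = 1 := by
  obtain ⟨l, hl, -, rfl⟩ := exists_word hS g
  rw [h, List.length_eq_zero_iff] at hl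
  simp [hl]

theorem one_le_wordLength (hS : Subgroup.closure S = ⊤) {g : G} (hg : g ≠ 1) :
    1 ≤ wordLength S g :=
  Nat.one_le_iff_ne_zero.2 fun h => hg (eq_one_of_wordLength_eq_zero hS h)

/-- A subadditive function bounded on the generators is dominated by the word length. -/
theorem le_mul_wordLength (hS : Subgroup.closure S = ⊤) {ℓ : G → ℝ} (h1 : ℓ 1 ≤ 0)
    (hmul : ∀ g h, ℓ (g * h) ≤ ℓ g + ℓ h) {M : ℝ} (hM : ∀ s ∈ S, ℓ s ≤ M ∧ ℓ s⁻¹ ≤ M) (g : G) :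
    ℓ g ≤ M * wordLength S g := by
  obtain ⟨l, hl, hl', rfl⟩ := exists_word hS g
  rw [← hl]
  clear hl
  induction l with
  | nil => simpa using h1
  | cons a l ih =>
    have ha : ℓ a ≤ M := by
      rcases hl' a (by simp) with h | h
      · exact (hM a h).1
      · simpa using (hM _ h).2
    have := hmul a l.prod
    have := ih fun s hs => hl' s (by simp [hs])
    simp only [List.prod_cons, List.length_cons, Nat.cast_add, Nat.cast_one]
    linarith

theorem exists_le_mul_wordLength (hSfin : S.Finite) (hS : Subgroup.closure S = ⊤) {ℓ : G → ℝ}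
    (h1 : ℓ 1 ≤ 0) (hmul : ∀ g h, ℓ (g * h) ≤ ℓ g + ℓ h) :
    ∃ M : ℝ, 0 < M ∧ ∀ g, ℓ g ≤ M * wordLength S g := by
  obtain ⟨M, hM⟩ := (hSfin.image fun s => max (ℓ s) (ℓ s⁻¹)).bddAbove
  refine ⟨max M 1, by positivity, le_mul_wordLength hS h1 hmul fun s hs => ?_⟩
  have := hM (Set.mem_image_of_mem _ hs)
  simp only [max_le_iff] at this
  exact ⟨le_max_of_le_left this.1, le_max_of_le_left this.2⟩

/-- Balls of a finitely generated group are finite, so an infinite one has arbitrarily long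
elements. -/
theorem exists_le_wordLength [Infinite G] (hSfin : S.Finite) (hS : Subgroup.closure S = ⊤)
    (n : ℕ) : ∃ g : G, n ≤ wordLength S g := by
  by_contra! h
  have hT : (S ∪ S⁻¹).Finite := hSfin.union hSfin.inv
  have : Finite ↥(S ∪ S⁻¹) := hT
  refine Set.infinite_univ (α := G) (((List.finite_length_le ↥(S ∪ S⁻¹) n).image
    fun l => (l.map Subtype.val).prod).subset fun g _ => ?_)
  obtain ⟨l, hl, hl', rfl⟩ := exists_word hS g
  lift l to List ↥(S ∪ S⁻¹) using hl'
  exact ⟨l, by simpa using hl.le.trans (h _).le, rfl⟩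

end WordLength

section Exponent

variable {G : Type*} [Group G] {S : Set G} {X : Type*} [NormedAddCommGroup X] [NormedSpace ℝ X]

theorem IsEquivariant.norm_sub {Ψ : G → X} (h : IsEquivariant Ψ) (x y : G) :
    ‖Ψ x - Ψ y‖ = ‖Ψ (x⁻¹ * y) - Ψ 1‖ := by
  obtain ⟨τ, v, hv⟩ := h
  have hy : Ψ y = τ x (Ψ (x⁻¹ * y)) := by
    rw [hv y, hv (x⁻¹ * y), ← Function.comp_apply (f := τ x), ← AffineIsometryEquiv.coe_mul,
      ← map_mul, mul_inv_cancel_left]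
  have hx : Ψ x = τ x (Ψ 1) := by
    rw [hv x, hv 1, ← Function.comp_apply (f := τ x), ← AffineIsometryEquiv.coe_mul, ← map_mul,
      mul_one]
  rw [hx, hy, ← dist_eq_norm, AffineIsometryEquiv.dist_map, dist_comm, dist_eq_norm]

theorem IsEquivariant.norm_mul_le {Ψ : G → X} (h : IsEquivariant Ψ) (x y : G) :
    ‖Ψ (x * y) - Ψ 1‖ ≤ ‖Ψ x - Ψ 1‖ + ‖Ψ y - Ψ 1‖ := by
  have h1 : ‖Ψ (x * y) - Ψ x‖ = ‖Ψ y - Ψ 1‖ := by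
    rw [norm_sub_rev, h.norm_sub, inv_mul_cancel_left]
  rw [← h1, add_comm]
  exact norm_sub_le_norm_sub_add_norm_sub _ _ _

theorem IsEquivariant.norm_inv {Ψ : G → X} (h : IsEquivariant Ψ) (x : G) :
    ‖Ψ x⁻¹ - Ψ 1‖ = ‖Ψ x - Ψ 1‖ := by
  rw [norm_sub_rev (Ψ x), h.norm_sub 1 x, h.norm_sub x⁻¹ 1]
  simp

theorem IsEquivariant.exists_le_mul_wordLength (hSfin : S.Finite)
    (hS : Subgroup.closure S = ⊤) {Ψ : G → X} (h : IsEquivariant Ψ) :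
    ∃ M : ℝ, 0 < M ∧ ∀ g, ‖Ψ g - Ψ 1‖ ≤ M * wordLength S g :=
  Compression.exists_le_mul_wordLength hSfin hS (ℓ := fun g => ‖Ψ g - Ψ 1‖) (by simp)
    h.norm_mul_le

/-- Equivariant maps on a finitely generated group are Lipschitz. -/
theorem IsEquivariant.isWordLipschitz (hSfin : S.Finite) (hS : Subgroup.closure S = ⊤)
    {Ψ : G → X} (h : IsEquivariant Ψ) : IsWordLipschitz S Ψ := by
  obtain ⟨M, -, hM⟩ := h.exists_le_mul_wordLength hSfin hS
  exact ⟨M, fun x y => (h.norm_sub x y).trans_le (hM _)⟩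

/-- The exponent `β` is admissible for `(G, S)` in `X` if some equivariant map `Ψ : G → X` satisfies
`‖Ψ g - Ψ 1‖ ≥ c |g| ^ β` for all `g ≠ 1`. Since equivariant maps are automatically Lipschitz, the
equivariant compression exponent is the supremum of these `β ≥ 0`. -/
def Admissible (S : Set G) (X : Type*) [NormedAddCommGroup X] [NormedSpace ℝ X] (β : ℝ) : Prop :=
  ∃ Ψ : G → X, IsEquivariant Ψ ∧
    ∃ c : ℝ, 0 < c ∧ ∀ g : G, g ≠ 1 → c * (wordLength S g : ℝ) ^ β ≤ ‖Ψ g - Ψ 1‖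

theorem IsEquivariant.le_compression_iff (hS : Subgroup.closure S = ⊤) {Ψ : G → X}
    (h : IsEquivariant Ψ) {c β : ℝ} (hc : 0 < c) (hβ : 0 ≤ β) :
    (∀ t : ℝ, 1 ≤ t → ENNReal.ofReal (c * t ^ β) ≤ compression S Ψ t) ↔
      ∀ g : G, g ≠ 1 → c * (wordLength S g : ℝ) ^ β ≤ ‖Ψ g - Ψ 1‖ := by
  constructor
  · intro H g hg
    have h1 : (1 : ℝ) ≤ wordLength S g := by exact_mod_cast one_le_wordLength hS hg
    have := (H _ h1).trans (iInf₂_le_of_le 1 g (iInf_le _ (by simp)))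
    rw [ENNReal.ofReal_le_ofReal_iff (norm_nonneg _), norm_sub_rev] at this
    exact this
  · intro H t ht
    refine le_iInf₂ fun x y => le_iInf fun hxy => ENNReal.ofReal_le_ofReal ?_
    rw [h.norm_sub x y]
    have hne : x⁻¹ * y ≠ 1 := by
      intro h1
      rw [h1, wordLength_one] at hxy
      norm_num at hxy
      linarith
    refine le_trans ?_ (H _ hne)
    gcongr

/-- Equivariant maps are automatically Lipschitz, and by equivariance the compression function only
sees the displacement, so the exponent is the supremum of the admissible exponents. -/
theorem equivariantExponent_eq (hSfin : S.Finite) (hS : Subgroup.closure S = ⊤) :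
    equivariantExponent S X = ⨆ (β : ℝ≥0) (_ : Admissible S X β), (β : ℝ≥0∞) := by
  apply le_antisymm
  · refine iSup_le fun Ψ => iSup_le fun _ => iSup_le fun h => iSup_le fun β => iSup_le ?_
    rintro ⟨c, hc, H⟩
    exact le_iSup₂_of_le β
      ⟨Ψ, h, c, hc, (h.le_compression_iff hS hc β.2).1 H⟩ le_rfl
  · refine iSup_le fun β => iSup_le ?_
    rintro ⟨Ψ, h, c, hc, H⟩
    refine le_iSup_of_le Ψ (le_iSup₂_of_le (h.isWordLipschitz hSfin hS) h ?_)
    exact le_iSup₂_of_le β ⟨c, hc, (h.le_compression_iff hS hc β.2).2 H⟩ le_rfl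

/-- On an infinite group the word length is unbounded, so an exponent above `1` would contradict the
Lipschitz bound. -/
theorem Admissible.le_one [Infinite G] (hSfin : S.Finite) (hS : Subgroup.closure S = ⊤) {β : ℝ}
    (h : Admissible S X β) : β ≤ 1 := by
  obtain ⟨Ψ, hΨ, c, hc, H⟩ := h
  obtain ⟨M, hM0, hM⟩ := hΨ.exists_le_mul_wordLength hSfin hS
  by_contra! hβ
  have hlim : Filter.Tendsto (fun n : ℕ => (n : ℝ) ^ (β - 1)) Filter.atTop Filter.atTop :=
    (tendsto_rpow_atTop (by linarith)).comp tendsto_natCast_atTop_atTop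
  obtain ⟨n, hn, hn1⟩ := ((hlim.eventually_gt_atTop (M / c)).and
    (Filter.eventually_ge_atTop 1)).exists
  obtain ⟨g, hg⟩ := exists_le_wordLength hSfin hS n
  have hg1 : g ≠ 1 := by
    rintro rfl
    rw [wordLength_one] at hg
    omega
  have hpos : (0 : ℝ) < wordLength S g := by exact_mod_cast one_le_wordLength hS hg1
  have h1 := (H g hg1).trans (hM g)
  have h2 : (wordLength S g : ℝ) ^ β = (wordLength S g : ℝ) ^ (β - 1) * wordLength S g := by
    rw [Real.rpow_sub_one hpos.ne', div_mul_cancel₀ _ hpos.ne']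
  rw [h2, ← mul_assoc] at h1
  have h3 := le_of_mul_le_mul_right h1 hpos
  have h4 : (n : ℝ) ^ (β - 1) ≤ (wordLength S g : ℝ) ^ (β - 1) :=
    Real.rpow_le_rpow (by positivity) (by exact_mod_cast hg) (by linarith)
  rw [div_lt_iff₀ hc] at hn
  nlinarith

end Exponent

end Compression

/-! ### Word length in the wreath product -/

namespace WreathZ

variable {H : Type*} [Group H]

/-- The copy of `H` in `H ≀ ℤ` that acts on the lamp at `0`. -/
def lampHom : H →* WreathZ H where
  toFun h :=
    { lamp := Pi.mulSingle 0 h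
      pos := 0
      finite_support := (Set.finite_singleton 0).subset Pi.mulSupport_mulSingle_subset }
  map_one' := by ext x <;> simp
  map_mul' a b := by
    ext x
    · simp [Pi.mulSingle_mul]
    · simp

@[simp] theorem lampHom_lamp (h : H) (x : ℤ) :
    (lampHom h).lamp x = if x = 0 then h else 1 := by
  simp [lampHom, Pi.mulSingle_apply]

@[simp] theorem lampHom_pos (h : H) : (lampHom h).pos = 0 := rfl

/-- The cursor moves: `shift i = (1, i)`. -/
def shift (i : ℤ) : WreathZ H where
  lamp := fun _ => 1
  pos := i
  finite_support := by simp

@[simp] theorem shift_lamp (i x : ℤ) : (shift i : WreathZ H).lamp x = 1 := rfl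

@[simp] theorem shift_pos (i : ℤ) : (shift i : WreathZ H).pos = i := rfl

theorem shift_add (i j : ℤ) : (shift (i + j) : WreathZ H) = shift i * shift j := by
  ext x <;> simp

theorem shift_zero : (shift 0 : WreathZ H) = 1 := by ext x <;> simp

theorem shift_inv (i : ℤ) : (shift i : WreathZ H)⁻¹ = shift (-i) := by ext x <;> simp

/-- The reflection `(f, i) ↦ (f(-·), -i)`, an automorphism of `H ≀ ℤ`. -/
def reflect : WreathZ H →* WreathZ H where
  toFun g :=
    { lamp := fun x => g.lamp (-x)
      pos := -g.pos
      finite_support := g.finite_support.preimage (f := fun x : ℤ => -x) neg_injective.injOn }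
  map_one' := by ext x <;> simp
  map_mul' a b := by
    ext x
    · simp only [lamp_mul]
      congr 2
      ring
    · simp only [pos_mul]; ring

@[simp] theorem reflect_lamp (g : WreathZ H) (x : ℤ) : (reflect g).lamp x = g.lamp (-x) := rfl

@[simp] theorem reflect_pos (g : WreathZ H) : (reflect g).pos = -g.pos := rfl

/-- The lamps lit at the positions satisfying `P`, cursor at the origin. -/
def restrict (P : ℤ → Prop) [DecidablePred P] (g : WreathZ H) : WreathZ H where
  lamp x := if P x then g.lamp x else 1
  pos := 0
  finite_support := g.finite_support.subset fun x hx => by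
    simp only [Function.mem_mulSupport] at hx ⊢
    intro h
    simp [h] at hx

@[simp] theorem restrict_lamp (P : ℤ → Prop) [DecidablePred P] (g : WreathZ H) (x : ℤ) :
    (restrict P g).lamp x = if P x then g.lamp x else 1 := rfl

@[simp] theorem restrict_pos (P : ℤ → Prop) [DecidablePred P] (g : WreathZ H) :
    (restrict P g).pos = 0 := rfl

theorem eq_restrict_mul_restrict_mul_shift (g : WreathZ H) :
    g = restrict (fun x => 0 ≤ x) g * restrict (fun x => x < 0) g * shift g.pos := by
  ext x
  · rcases le_or_gt 0 x with h | h
    · simp [h, h.not_gt]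
    · simp [h, h.not_ge]
  · simp

/-- The peeling step: a configuration on `ε {0, …, n}` is its lamp at the origin followed by a
configuration on `ε {0, …, n - 1}` seen from the neighbouring cursor position `ε`. -/
theorem eq_lampHom_mul_conj (g : WreathZ H) (ε : ℤ) :
    g = lampHom (g.lamp 0) * (shift ε * (shift (-ε) * (lampHom (g.lamp 0))⁻¹ * g * shift ε) *
      shift (-ε)) := by
  have : shift (-ε) = (shift ε : WreathZ H)⁻¹ := (shift_inv ε).symm
  rw [this]
  group

/-- Elements whose lamps are supported on one side are obtained by sweeping that side. The conclusion
is stated for an abstract length `ℓ`. -/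
theorem length_le_of_oneSided {ℓ : WreathZ H → ℝ} (h1 : ℓ 1 ≤ 0)
    (hmul : ∀ g h, ℓ (g * h) ≤ ℓ g + ℓ h) {ε : ℤ} (hε : ε = 1 ∨ ε = -1) {M : ℝ}
    (hM : ℓ (shift ε) ≤ M ∧ ℓ (shift (-ε)) ≤ M) {L : H → ℝ} (hL : ∀ h, ℓ (lampHom h) ≤ L h)
    (n : ℕ) (g : WreathZ H) (hg : g.pos = 0)
    (hsupp : ∀ x, g.lamp x ≠ 1 → ∃ k : ℕ, k < n ∧ x = ε * k) :
    ℓ g ≤ 2 * M * n + ∑ k ∈ Finset.range n, L (g.lamp (ε * k)) := by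
  induction n generalizing g with
  | zero =>
    have : g = 1 := by
      ext x
      · by_contra h
        obtain ⟨k, hk, -⟩ := hsupp x h
        omega
      · simpa using hg
    simpa [this] using h1
  | succ n ih =>
    set g' := shift (-ε) * (lampHom (g.lamp 0))⁻¹ * g * shift ε with hg'
    have hlamp : ∀ x, g'.lamp x = if x + ε = 0 then 1 else g.lamp (x + ε) := by
      intro x
      by_cases hx : x + ε = 0 <;> simp [hg', hx]
    have ih' := ih g' (by simp [hg', hg]) (by
      intro x hx
      rw [hlamp] at hx
      split_ifs at hx with h0
      · exact absurd rfl hx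
      obtain ⟨k, hk, hxk⟩ := hsupp _ hx
      rcases Nat.exists_eq_succ_of_ne_zero (n := k) (by rintro rfl; simp at hxk; omega) with ⟨j, rfl⟩
      refine ⟨j, by omega, ?_⟩
      push_cast at hxk
      linarith)
    have hsum : ∑ k ∈ Finset.range n, L (g'.lamp (ε * k)) =
        ∑ k ∈ Finset.range n, L (g.lamp (ε * ((k + 1 : ℕ) : ℤ))) := by
      refine Finset.sum_congr rfl fun k _ => ?_
      have h2 : ε * (k : ℤ) + ε = ε * ((k + 1 : ℕ) : ℤ) := by push_cast; ring
      have h3 : ε * ((k + 1 : ℕ) : ℤ) ≠ 0 := by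
        refine mul_ne_zero ?_ (by positivity)
        rintro rfl
        simp at hε
      rw [hlamp, h2, if_neg h3]
    rw [Finset.sum_range_succ', ← hsum]
    have e := eq_lampHom_mul_conj g ε
    rw [← hg'] at e
    have b1 := hmul (lampHom (g.lamp 0)) (shift ε * g' * shift (-ε))
    have b2 := hmul (shift ε * g') (shift (-ε))
    have b3 := hmul (shift ε) g'
    rw [← e] at b1
    have b4 := hL (g.lamp 0)
    push_cast
    simp only [mul_zero]
    linarith [hM.1, hM.2]

theorem length_shift_le {ℓ : WreathZ H → ℝ} (h1 : ℓ 1 ≤ 0)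
    (hmul : ∀ g h, ℓ (g * h) ≤ ℓ g + ℓ h) {M : ℝ}
    (hM : ℓ (shift 1) ≤ M ∧ ℓ (shift (-1)) ≤ M) (i : ℤ) : ℓ (shift i) ≤ M * |(i : ℝ)| := by
  have key : ∀ (ε : ℤ), ℓ (shift ε) ≤ M → ∀ n : ℕ, ℓ (shift (ε * n)) ≤ M * n := by
    intro ε hε n
    induction n with
    | zero => simpa [shift_zero] using h1
    | succ n ih =>
      have : ε * ((n + 1 : ℕ) : ℤ) = ε * n + ε := by push_cast; ring
      rw [this, shift_add]
      push_cast
      linarith [hmul (shift (ε * n)) (shift ε)]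
  rcases Int.eq_nat_or_neg i with ⟨n, rfl | rfl⟩
  · simpa using key 1 hM.1 n
  · simpa using key (-1) hM.2 n

/-- The upper bound on length: sweeping all lit lamps. -/
theorem length_le {ℓ : WreathZ H → ℝ} (h1 : ℓ 1 ≤ 0)
    (hmul : ∀ g h, ℓ (g * h) ≤ ℓ g + ℓ h) {M : ℝ}
    (hM : ℓ (shift 1) ≤ M ∧ ℓ (shift (-1)) ≤ M) {L : H → ℝ} (hL : ∀ h, ℓ (lampHom h) ≤ L h)
    (hL1 : L 1 = 0) {R : ℕ} (g : WreathZ H) (hR : ∀ x, g.lamp x ≠ 1 → |x| < R) :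
    ℓ g ≤ M * |(g.pos : ℝ)| + 4 * M * R + ∑ x ∈ Finset.Ioo (-R : ℤ) R, L (g.lamp x) := by
  have hp := length_le_of_oneSided (ε := 1) h1 hmul (by simp) hM hL R (restrict (fun x => 0 ≤ x) g)
    rfl (by
      intro x hx
      simp only [restrict_lamp, ne_eq, ite_eq_right_iff, Classical.not_imp] at hx
      have := hR x hx.2
      rw [abs_of_nonneg hx.1] at this
      exact ⟨x.toNat, by omega, by omega⟩)
  have hn := length_le_of_oneSided (ε := -1) h1 hmul (by simp) (by simpa using hM.symm) hL R
    (restrict (fun x => x < 0) g) rfl (by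
      intro x hx
      simp only [restrict_lamp, ne_eq, ite_eq_right_iff, Classical.not_imp] at hx
      have := hR x hx.2
      rw [abs_of_neg hx.1] at this
      exact ⟨(-x).toNat, by omega, by omega⟩)
  have hs := length_shift_le h1 hmul hM g.pos
  have e := eq_restrict_mul_restrict_mul_shift g
  have b1 := hmul (restrict (fun x => 0 ≤ x) g * restrict (fun x => x < 0) g) (shift g.pos)
  have b2 := hmul (restrict (fun x => 0 ≤ x) g) (restrict (fun x => x < 0) g)
  rw [← e] at b1
  have hsum : ∑ k ∈ Finset.range R, L ((restrict (fun x => 0 ≤ x) g).lamp (1 * k)) +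
      ∑ k ∈ Finset.range R, L ((restrict (fun x => x < 0) g).lamp (-1 * k)) =
      ∑ x ∈ Finset.Ioo (-R : ℤ) R, L (g.lamp x) := by
    have hsplit : ∑ x ∈ Finset.Ioo (-R : ℤ) R, L (g.lamp x) =
        ∑ x ∈ Finset.Ioo (-R : ℤ) R, L ((restrict (fun x => 0 ≤ x) g).lamp x) +
        ∑ x ∈ Finset.Ioo (-R : ℤ) R, L ((restrict (fun x => x < 0) g).lamp x) := by
      rw [← Finset.sum_add_distrib]
      refine Finset.sum_congr rfl fun x _ => ?_
      rcases le_or_gt 0 x with h | h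
      · simp [h, h.not_gt, hL1]
      · simp [h, h.not_ge, hL1]
    rw [hsplit]
    congr 1
    · refine Finset.sum_of_injOn (fun k : ℕ => (1 : ℤ) * k) ?_ ?_ ?_ (fun _ _ => rfl)
      · intro a _ b _ h
        simpa using h
      · intro a ha
        simp only [Finset.coe_range, Set.mem_Iio, Finset.coe_Ioo, Set.mem_Ioo] at ha ⊢
        omega
      · intro x hx hx'
        have : ¬ 0 ≤ x := by
          intro h0
          refine hx' ⟨x.toNat, ?_, ?_⟩
          · simp only [Finset.mem_Ioo, Finset.coe_range, Set.mem_Iio] at hx ⊢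
            omega
          · simp [h0]
        simp [this, hL1]
    · refine Finset.sum_of_injOn (fun k : ℕ => (-1 : ℤ) * k) ?_ ?_ ?_ (fun _ _ => rfl)
      · intro a _ b _ h
        simpa using h
      · intro a ha
        simp only [Finset.coe_range, Set.mem_Iio, Finset.coe_Ioo, Set.mem_Ioo] at ha ⊢
        omega
      · intro x hx hx'
        have : 0 ≤ x := by
          by_contra h0
          refine hx' ⟨(-x).toNat, ?_, ?_⟩
          · simp only [Finset.mem_Ioo, Finset.coe_range, Set.mem_Iio] at hx ⊢
            omega
          · have : (((-x).toNat : ℕ) : ℤ) = -x := Int.toNat_of_nonneg (by omega)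
            simp only
            omega
        simp [this.not_gt, hL1]
  linarith

theorem exists_support_bound (g : WreathZ H) : ∃ R : ℕ, ∀ x, g.lamp x ≠ 1 → |x| < R := by
  obtain ⟨M, hM⟩ := (g.finite_support.image fun x => |x|).bddAbove
  refine ⟨(M + 1).toNat, fun x hx => ?_⟩
  have := hM (Set.mem_image_of_mem (fun x => |x|) (show x ∈ Function.mulSupport g.lamp from hx))
  omega

theorem closure_eq_top {S : Set H} (hS : Subgroup.closure S = ⊤) :
    Subgroup.closure (lampHom '' S ∪ {shift 1} : Set (WreathZ H)) = ⊤ := by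
  set K := Subgroup.closure (lampHom '' S ∪ {shift 1} : Set (WreathZ H))
  have hlamp : ∀ h, lampHom h ∈ K := by
    intro h
    have : (Subgroup.closure S).map (lampHom (H := H)) ≤ K := by
      rw [MonoidHom.map_closure]
      exact Subgroup.closure_mono Set.subset_union_left
    exact this ⟨h, by simp [hS], rfl⟩
  have hshift : (shift 1 : WreathZ H) ∈ K := Subgroup.subset_closure (by simp)
  have hshift' : (shift (-1) : WreathZ H) ∈ K := by
    rw [← shift_inv]
    exact K.inv_mem hshift
  rw [eq_top_iff]
  intro g _
  -- the indicator function of the complement of `K` is subadditive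
  classical
  obtain ⟨R, hR⟩ := exists_support_bound g
  have := length_le (ℓ := fun g => if g ∈ K then (0 : ℝ) else 1) (M := 0) (L := fun _ => 0)
    (by simp [K.one_mem]) (by
      intro a b
      by_cases ha : a ∈ K
      · simp [K.mul_mem_cancel_left ha, ha]
      · simp only [ha, if_false]
        split_ifs <;> norm_num) (by simp [hshift, hshift']) (by simp [hlamp]) rfl g hR
  by_contra hg
  simp only [hg, if_false] at this
  norm_num at this

theorem fg_of_finite {S : Set H} (hSfin : S.Finite) (hS : Subgroup.closure S = ⊤) :
    Group.FG (WreathZ H) :=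
  ⟨⟨((hSfin.image lampHom).union (Set.finite_singleton (shift 1))).toFinset, by
    rw [Set.Finite.coe_toFinset]
    exact closure_eq_top hS⟩⟩

open Compression

/-- The upper bound `|(f, i)| ≤ M (|i| + 4 R + ∑ |f x|)` on the word length when `f` is supported
on `(-R, R)`. -/
theorem exists_wordLength_le {S : Set H} (hSfin : S.Finite) (hS : Subgroup.closure S = ⊤)
    {T : Set (WreathZ H)} (hT : Subgroup.closure T = ⊤) :
    ∃ M : ℝ, 0 < M ∧ ∀ (g : WreathZ H) (R : ℕ), (∀ x, g.lamp x ≠ 1 → |x| < R) →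
      wordLength T g ≤ M * (|(g.pos : ℝ)| + 4 * R +
        ∑ x ∈ Finset.Ioo (-R : ℤ) R, (wordLength S (g.lamp x) : ℝ)) := by
  have hmul : ∀ g h : WreathZ H, (wordLength T (g * h) : ℝ) ≤ wordLength T g + wordLength T h := by
    intro g h
    exact_mod_cast wordLength_mul_le hT g h
  obtain ⟨M, hM0, hM⟩ := exists_le_mul_wordLength hSfin hS
    (ℓ := fun h => (wordLength T (lampHom h) : ℝ)) (by simp [wordLength_one])
    (by intro g h; simpa using hmul (lampHom g) (lampHom h))
  set M' := M + wordLength T (shift 1) + wordLength T (shift (-1))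
  have hM' : M ≤ M' := by
    have : (0 : ℝ) ≤ wordLength T (shift 1) + wordLength T (shift (-1)) := by positivity
    simp only [M']
    linarith
  refine ⟨M', by linarith, fun g R hR => ?_⟩
  have := length_le (ℓ := fun g => (wordLength T g : ℝ)) (M := M')
    (L := fun h => M' * wordLength S h) (by simp [wordLength_one]) hmul
    (by
      have h1 : (0 : ℝ) ≤ wordLength T (shift 1) := by positivity
      have h2 : (0 : ℝ) ≤ wordLength T (shift (-1)) := by positivity
      simp only [M']
      constructor <;> linarith)
    (fun h => (hM h).trans (by gcongr)) (by simp [wordLength_one]) g hR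
  refine this.trans (le_of_eq ?_)
  rw [← Finset.mul_sum]
  ring

theorem finite_support_length (S : Set H) (g : WreathZ H) :
    (Function.support fun x => (wordLength S (g.lamp x) : ℝ)).Finite :=
  g.finite_support.subset fun x hx => by
    simp only [Function.mem_support, ne_eq, Nat.cast_eq_zero] at hx
    rw [Function.mem_mulSupport]
    intro h
    exact hx (by rw [h, wordLength_one])

/-- The lower bound: the total length of the lamps is at most a multiple of the word length. -/
theorem exists_lampLength_le {S : Set H} (hS : Subgroup.closure S = ⊤)
    {T : Set (WreathZ H)} (hTfin : T.Finite) (hT : Subgroup.closure T = ⊤) :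
    ∃ M : ℝ, 0 < M ∧ ∀ g : WreathZ H,
      ∑ᶠ x, (wordLength S (g.lamp x) : ℝ) ≤ M * wordLength T g := by
  refine exists_le_mul_wordLength hTfin hT (by simp [wordLength_one]) fun g h => ?_
  have e : ∑ᶠ x, (wordLength S (h.lamp x) : ℝ) = ∑ᶠ x, (wordLength S (h.lamp (x - g.pos)) : ℝ) :=
    (finsum_comp_equiv (Equiv.subRight g.pos) (f := fun x => (wordLength S (h.lamp x) : ℝ))).symm
  have hfin : (Function.support fun x => (wordLength S (h.lamp (x - g.pos)) : ℝ)).Finite :=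
    (finite_support_length S h).preimage (f := fun x => x - g.pos) (sub_left_injective.injOn)
  rw [e, ← finsum_add_distrib (finite_support_length S g) hfin]
  refine finsum_le_finsum' (finite_support_length S (g * h)) ?_ ?_
  · exact ((finite_support_length S g).union hfin).subset (Function.support_add _ _)
  · intro x
    change (wordLength S (g.lamp x * h.lamp (x - g.pos)) : ℝ) ≤ _ + _
    exact_mod_cast wordLength_mul_le hS _ _

end WreathZ

/-! ### A Poincaré inequality for lamplighter configurations -/

namespace Compression

section Interval

/-- Comparison of adjacent blocks of equal size: deviations from `c` on `B₂` are controlled by those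
on `B₁` and the differences between the blocks. -/
theorem sum_sq_sub_le_of_card_eq {B₁ B₂ : Finset ℕ} {M : ℕ} (hM : 0 < M) (h₁ : B₁.card = M)
    (h₂ : B₂.card = M) (hne : ∀ i ∈ B₂, ∀ j ∈ B₁, i ≠ j ∧ |(i : ℝ) - j| ≤ 2 * M)
    (v : ℕ → ℝ) (c : ℝ) {η : ℝ} (hη : 0 < η) :
    ∑ i ∈ B₂, (v i - c) ^ 2 ≤ (1 + η) * ∑ j ∈ B₁, (v j - c) ^ 2 +
      (1 + η⁻¹) * (4 * M) * ∑ i ∈ B₂, ∑ j ∈ B₁, ((v i - v j) / (i - j)) ^ 2 := by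
  have hM' : (0 : ℝ) < M := by exact_mod_cast hM
  have key : ∀ i ∈ B₂, ∀ j ∈ B₁, (v i - c) ^ 2 ≤ (1 + η) * (v j - c) ^ 2 +
      (1 + η⁻¹) * ((4 * M ^ 2) * ((v i - v j) / (i - j)) ^ 2) := by
    intro i hi j hj
    obtain ⟨hij, hd⟩ := hne i hi j hj
    have hij' : (i : ℝ) - j ≠ 0 := sub_ne_zero.2 (by exact_mod_cast hij)
    have h1 : (v i - v j) ^ 2 ≤ (4 * M ^ 2) * ((v i - v j) / (i - j)) ^ 2 := by
      have h2 : (v i - v j) ^ 2 = ((i : ℝ) - j) ^ 2 * ((v i - v j) / (i - j)) ^ 2 := by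
        field_simp
      have h3 : ((i : ℝ) - j) ^ 2 ≤ 4 * M ^ 2 := by
        rw [← sq_abs]
        nlinarith [abs_nonneg ((i : ℝ) - j)]
      calc (v i - v j) ^ 2 = ((i : ℝ) - j) ^ 2 * ((v i - v j) / (i - j)) ^ 2 := h2
        _ ≤ _ := by gcongr
    have h4 : (v i - c) ^ 2 ≤ (1 + η) * (v j - c) ^ 2 + (1 + η⁻¹) * (v i - v j) ^ 2 := by
      have h5 : (1 + η) * (v j - c) ^ 2 + (1 + η⁻¹) * (v i - v j) ^ 2 - (v i - c) ^ 2 =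
          η⁻¹ * (η * (v j - c) - (v i - v j)) ^ 2 := by
        field_simp
        ring
      have : 0 ≤ η⁻¹ * (η * (v j - c) - (v i - v j)) ^ 2 := by positivity
      linarith
    refine h4.trans ?_
    gcongr
  have hsum := Finset.sum_le_sum fun i hi => Finset.sum_le_sum (key i hi)
  simp only [Finset.sum_const, Finset.sum_add_distrib, ← Finset.mul_sum, nsmul_eq_mul, h₁, h₂]
    at hsum
  have : (M : ℝ) * ∑ i ∈ B₂, (v i - c) ^ 2 ≤ M * ((1 + η) * ∑ j ∈ B₁, (v j - c) ^ 2 +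
      (1 + η⁻¹) * (4 * M) * ∑ i ∈ B₂, ∑ j ∈ B₁, ((v i - v j) / (i - j)) ^ 2) := by
    refine hsum.trans (le_of_eq ?_)
    ring
  exact le_of_mul_le_mul_left this hM'

/-- Discrete fractional Sobolev inequality of critical exponent: on an interval of length `2 ^ K`,
the deviation of `v` from its value at a point is controlled, up to `K ^ 2`, by the energy with weights
`|i - j|⁻²`. -/
theorem sum_sq_sub_le_energy (K a x : ℕ) (hx : x ∈ Finset.Ico a (a + 2 ^ K)) (v : ℕ → ℝ) :
    ∑ i ∈ Finset.Ico a (a + 2 ^ K), (v i - v x) ^ 2 ≤ 3 * K ^ 2 * 2 ^ K *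
      ∑ i ∈ Finset.Ico a (a + 2 ^ K), ∑ j ∈ Finset.Ico a (a + 2 ^ K),
        ((v i - v j) / (i - j)) ^ 2 := by
  induction K generalizing a with
  | zero =>
    have : x = a := by simp at hx; omega
    simp [this]
  | succ K ih =>
    set M : ℕ := 2 ^ K with hMdef
    have hM : 0 < M := by positivity
    have hpow : a + 2 ^ (K + 1) = a + M + M := by rw [pow_succ]; omega
    rw [hpow] at hx ⊢
    set B := Finset.Ico a (a + M) with hB
    set B' := Finset.Ico (a + M) (a + M + M) with hB'
    have hcard : B.card = M := by simp [hB]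
    have hcard' : B'.card = M := by simp [hB']
    have hsplit : ∀ g : ℕ → ℝ, ∑ i ∈ Finset.Ico a (a + M + M), g i =
        ∑ i ∈ B, g i + ∑ i ∈ B', g i := fun g =>
      (Finset.sum_Ico_consecutive g (by omega) (by omega)).symm
    set D : ℕ → ℕ → ℝ := fun i j => ((v i - v j) / (i - j)) ^ 2 with hD
    have hDnn : ∀ s t : Finset ℕ, 0 ≤ ∑ i ∈ s, ∑ j ∈ t, D i j := fun s t =>
      Finset.sum_nonneg fun i _ => Finset.sum_nonneg fun j _ => sq_nonneg _
    have hdist : ∀ i ∈ B', ∀ j ∈ B, i ≠ j ∧ |(i : ℝ) - j| ≤ 2 * M := by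
      intro i hi j hj
      simp only [hB, hB', Finset.mem_Ico] at hi hj
      refine ⟨by omega, ?_⟩
      rw [abs_le]
      have h1 : (i : ℝ) ≤ a + M + M := by exact_mod_cast hi.2.le
      have h2 : (a : ℝ) ≤ j := by exact_mod_cast hj.1
      have h3 : (j : ℝ) ≤ i := by exact_mod_cast hj.2.le.trans hi.1
      constructor <;> linarith
    have hdist' : ∀ i ∈ B, ∀ j ∈ B', i ≠ j ∧ |(i : ℝ) - j| ≤ 2 * M := by
      intro i hi j hj
      rw [abs_sub_comm]
      exact ⟨(hdist j hj i hi).1.symm, (hdist j hj i hi).2⟩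
    have hK : (0 : ℝ) ≤ K := by positivity
    have hη : (0 : ℝ) < 2 / (K + 1) := by positivity
    -- the induction step, with the optimal choice `η = 2 / (K + 1)`
    have arith : ∀ S₁ S₂ E₁ E₂ E : ℝ, S₁ ≤ 3 * K ^ 2 * M * E₁ →
        S₂ ≤ (1 + 2 / (K + 1)) * S₁ + (1 + (2 / (K + 1) : ℝ)⁻¹) * (4 * M) * E₂ →
        0 ≤ E₁ → 0 ≤ E₂ → E₁ + E₂ ≤ E →
        S₁ + S₂ ≤ 3 * (K + 1 : ℝ) ^ 2 * (2 * M) * E := by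
      intro S₁ S₂ E₁ E₂ E h1 h2 he1 he2 he
      have hM' : (0 : ℝ) < M := by exact_mod_cast hM
      have h3 : S₁ + S₂ ≤ (2 + 2 / (K + 1)) * (3 * K ^ 2 * M * E₁) +
          (1 + (K + 1) / 2) * (4 * M) * E₂ := by
        rw [inv_div] at h2
        nlinarith
      have h4 : (2 + 2 / (K + 1 : ℝ)) * (3 * K ^ 2) ≤ 6 * (K + 1) ^ 2 := by
        rw [show (2 + 2 / (K + 1 : ℝ)) * (3 * K ^ 2) = (2 * K + 4) * (3 * K ^ 2) / (K + 1) by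
          field_simp; ring, div_le_iff₀ (by positivity)]
        nlinarith [mul_nonneg hK hK, mul_nonneg hK (mul_nonneg hK hK)]
      have h5 : (1 + (K + 1) / 2 : ℝ) * 4 ≤ 6 * (K + 1) ^ 2 := by nlinarith
      calc S₁ + S₂ ≤ (2 + 2 / (K + 1)) * (3 * K ^ 2) * (M * E₁) +
          (1 + (K + 1) / 2) * 4 * (M * E₂) := by linarith
        _ ≤ 6 * (K + 1) ^ 2 * (M * E₁) + 6 * (K + 1) ^ 2 * (M * E₂) := by gcongr
        _ = 3 * (K + 1 : ℝ) ^ 2 * (2 * M) * (E₁ + E₂) := by ring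
        _ ≤ _ := by gcongr
    have hM2 : (2 : ℝ) ^ (K + 1) = 2 * M := by rw [hMdef, pow_succ]; push_cast; ring
    have hM1 : (2 : ℝ) ^ K = M := by rw [hMdef]; push_cast; rfl
    rw [hM2]
    push_cast
    rw [hM1] at ih
    have hE : ∑ i ∈ Finset.Ico a (a + M + M), ∑ j ∈ Finset.Ico a (a + M + M), D i j =
        ∑ i ∈ B, ∑ j ∈ B, D i j + ∑ i ∈ B, ∑ j ∈ B', D i j +
          (∑ i ∈ B', ∑ j ∈ B, D i j + ∑ i ∈ B', ∑ j ∈ B', D i j) := by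
      simp only [hsplit, Finset.sum_add_distrib]
    rw [hsplit]
    rcases lt_or_ge x (a + M) with hxl | hxr
    · have h1 := ih a (by simp only [Finset.mem_Ico] at hx ⊢; omega)
      have h2 := sum_sq_sub_le_of_card_eq hM hcard hcard' hdist v (v x) hη
      refine arith _ _ _ _ _ h1 h2 (hDnn _ _) (hDnn _ _) ?_
      rw [hE]
      linarith [hDnn B B', hDnn B' B']
    · have h1 := ih (a + M) (by simp only [Finset.mem_Ico] at hx ⊢; omega)
      have h2 := sum_sq_sub_le_of_card_eq hM hcard' hcard hdist' v (v x) hη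
      rw [add_comm]
      refine arith _ _ _ _ _ h1 h2 (hDnn _ _) (hDnn _ _) ?_
      rw [hE]
      linarith [hDnn B B, hDnn B' B]

/-- The one-point Poincaré inequality on `{0, …, 2 ^ K - 1}`. -/
theorem sum_sq_le_energy (K : ℕ) (v : Fin (2 ^ K) → ℝ) (x : Fin (2 ^ K)) :
    ∑ i, v i ^ 2 ≤ (2 * 2 ^ K) * v x ^ 2 + ∑ i : Fin (2 ^ K), ∑ j : Fin (2 ^ K),
      6 * K ^ 2 * 2 ^ K / (((i : ℕ) : ℝ) - (j : ℕ)) ^ 2 * (v i - v j) ^ 2 := by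
  have hx : (x : ℕ) ∈ Finset.Ico 0 (0 + 2 ^ K) := by simp
  set w : ℕ → ℝ := fun i => if h : i < 2 ^ K then v ⟨i, h⟩ else 0 with hw
  have hwv : ∀ i : Fin (2 ^ K), w i = v i := fun i => by simp [hw]
  have h := sum_sq_sub_le_energy K 0 x hx w
  simp only [zero_add, ← Finset.range_eq_Ico, Finset.sum_range, hwv] at h
  have h1 : ∑ i, v i ^ 2 ≤ ∑ i, (2 * (v i - v x) ^ 2 + 2 * v x ^ 2) :=
    Finset.sum_le_sum fun i _ => by nlinarith [sq_nonneg (v i - 2 * v x)]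
  rw [Finset.sum_add_distrib, ← Finset.mul_sum, Finset.sum_const, Finset.card_univ,
    Fintype.card_fin, nsmul_eq_mul] at h1
  have h2 : ∑ i : Fin (2 ^ K), ∑ j : Fin (2 ^ K),
      6 * K ^ 2 * 2 ^ K / (((i : ℕ) : ℝ) - (j : ℕ)) ^ 2 * (v i - v j) ^ 2 =
      2 * (3 * K ^ 2 * 2 ^ K * ∑ i : Fin (2 ^ K), ∑ j : Fin (2 ^ K),
        ((v i - v j) / (((i : ℕ) : ℝ) - (j : ℕ))) ^ 2) := by
    simp only [Finset.mul_sum]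
    refine Finset.sum_congr rfl fun i _ => Finset.sum_congr rfl fun j _ => ?_
    rw [div_pow]
    ring
  rw [h2]
  push_cast at h1
  linarith

end Interval

section Flips

variable {X : Type*} [DecidableEq X]

/-- Average of `w` over the flip of the bit `x`. -/
noncomputable def flipAvg (x : X) (w : (X → ZMod 2) → ℝ) (f : X → ZMod 2) : ℝ :=
  (w f + w (f + Pi.single x 1)) / 2

/-- Half the difference of `w` under the flip of the bit `x`. -/
noncomputable def flipDiff (x : X) (w : (X → ZMod 2) → ℝ) (f : X → ZMod 2) : ℝ :=
  (w f - w (f + Pi.single x 1)) / 2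

theorem add_single_add_single (f : X → ZMod 2) (x : X) :
    f + Pi.single x 1 + Pi.single x 1 = f := by
  rw [add_assoc, ← Pi.single_add, show (1 : ZMod 2) + 1 = 0 from rfl]
  simp

theorem flipDiff_flipAvg (x y : X) (w : (X → ZMod 2) → ℝ) :
    flipDiff y (flipAvg x w) = flipAvg x (flipDiff y w) := by
  funext f
  simp only [flipDiff, flipAvg, add_right_comm f (Pi.single y 1) (Pi.single x 1)]
  ring

/-- Average of `w` over all flips of bits in the list `l`. -/
noncomputable def listAvg : List X → ((X → ZMod 2) → ℝ) → (X → ZMod 2) → ℝ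
  | [], w => w
  | x :: l, w => listAvg l (flipAvg x w)

theorem listAvg_add_single_of_invariant (l : List X) {w : (X → ZMod 2) → ℝ} {x : X}
    (h : ∀ f, w (f + Pi.single x 1) = w f) (f : X → ZMod 2) :
    listAvg l w (f + Pi.single x 1) = listAvg l w f := by
  induction l generalizing w with
  | nil => exact h f
  | cons y l ih =>
    refine ih fun f => ?_
    simp only [flipAvg, h, add_right_comm f (Pi.single x 1) (Pi.single y 1)]

theorem listAvg_add_single {l : List X} {x : X} (hx : x ∈ l) (w : (X → ZMod 2) → ℝ)
    (f : X → ZMod 2) : listAvg l w (f + Pi.single x 1) = listAvg l w f := by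
  induction l generalizing w with
  | nil => simp at hx
  | cons y l ih =>
    rcases List.mem_cons.1 hx with rfl | h
    · refine listAvg_add_single_of_invariant l (fun f => ?_) f
      simp only [flipAvg, add_single_add_single]
      ring
    · exact ih h _

theorem listAvg_odd (l : List X) {w : (X → ZMod 2) → ℝ} {e : X → ZMod 2}
    (h : ∀ f, w (f + e) = - w f) (f : X → ZMod 2) : listAvg l w (f + e) = - listAvg l w f := by
  induction l generalizing w with
  | nil => exact h f
  | cons y l ih =>
    refine ih fun f => ?_
    simp only [flipAvg, h, add_right_comm f e (Pi.single y 1)]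
    ring

variable [Fintype X]

/-- An odd function on the cube has mean zero. -/
theorem listAvg_univ_eq_zero {w : (X → ZMod 2) → ℝ} (h : ∀ f, w (f + 1) = - w f) :
    listAvg Finset.univ.toList w = 0 := by
  funext f
  have hinv : ∀ s : Finset X, ∀ f, listAvg Finset.univ.toList w (f + ∑ x ∈ s, Pi.single x 1) =
      listAvg Finset.univ.toList w f := by
    intro s
    induction s using Finset.induction_on with
    | empty => simp
    | insert x s hx ih =>
      intro f
      rw [Finset.sum_insert hx, ← add_assoc, ih, listAvg_add_single (by simp)]
  have h1 : (∑ x : X, Pi.single x 1 : X → ZMod 2) = 1 := by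
    have := Finset.univ_sum_single (1 : X → ZMod 2)
    simpa using this
  have h2 := hinv Finset.univ f
  rw [h1, listAvg_odd _ h] at h2
  simp only [Pi.zero_apply]
  linarith

theorem sum_flipAvg_sq_add (x : X) (w : (X → ZMod 2) → ℝ) :
    ∑ f, flipAvg x w f ^ 2 + ∑ f, flipDiff x w f ^ 2 = ∑ f, w f ^ 2 := by
  have h : ∑ f, w (f + Pi.single x 1) ^ 2 = ∑ f, w f ^ 2 :=
    Fintype.sum_equiv (Equiv.addRight (Pi.single x 1 : X → ZMod 2)) _ _ fun _ => rfl
  rw [← Finset.sum_add_distrib]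
  have : ∀ f, flipAvg x w f ^ 2 + flipDiff x w f ^ 2 =
      (w f ^ 2 + w (f + Pi.single x 1) ^ 2) / 2 := by
    intro f
    simp only [flipAvg, flipDiff]
    ring
  rw [Finset.sum_congr rfl fun f _ => this f, ← Finset.sum_div, Finset.sum_add_distrib, h]
  ring

/-- The energy of `u`, in the position variable, summed over all bit configurations. -/
noncomputable def energy (W : X → X → ℝ) (u : X → (X → ZMod 2) → ℝ) : ℝ :=
  ∑ i, ∑ j, W i j * ∑ f, (u i f - u j f) ^ 2

theorem energy_flip (W : X → X → ℝ) (x : X) (u : X → (X → ZMod 2) → ℝ) :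
    energy W (fun i => flipAvg x (u i)) + energy W (fun i => flipDiff x (u i)) = energy W u := by
  simp only [energy, ← Finset.sum_add_distrib, ← mul_add]
  refine Finset.sum_congr rfl fun i _ => Finset.sum_congr rfl fun j _ => ?_
  rw [← sum_flipAvg_sq_add x (fun f => u i f - u j f), ← Finset.sum_add_distrib]
  congr 1
  refine Finset.sum_congr rfl fun f _ => ?_
  simp only [flipAvg, flipDiff]
  ring

/-- The martingale decomposition along the bits of `l`: the bit `x` is resolved from its own
position `x` by means of the one-point Poincaré inequality `hW`. -/
theorem sum_sq_le_listAvg {W : X → X → ℝ} {A : ℝ} (hA : 0 ≤ A)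
    (hW : ∀ (v : X → ℝ) (x : X),
      ∑ i, v i ^ 2 ≤ A * v x ^ 2 + ∑ i, ∑ j, W i j * (v i - v j) ^ 2)
    (l : List X) (u : X → (X → ZMod 2) → ℝ) :
    ∑ i, ∑ f, u i f ^ 2 ≤ ∑ i, ∑ f, listAvg l (u i) f ^ 2 +
      A * (l.map fun x => ∑ f, flipDiff x (u x) f ^ 2).sum +
      (energy W u - energy W fun i => listAvg l (u i)) := by
  induction l generalizing u with
  | nil => simp [listAvg]
  | cons x l ih =>
    have h1 := ih fun i => flipAvg x (u i)
    have h2 : (l.map fun y => ∑ f, flipDiff y (flipAvg x (u y)) f ^ 2).sum ≤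
        (l.map fun y => ∑ f, flipDiff y (u y) f ^ 2).sum := by
      refine List.sum_le_sum fun y _ => ?_
      rw [flipDiff_flipAvg, ← sum_flipAvg_sq_add x (flipDiff y (u y))]
      exact le_add_of_nonneg_right (Finset.sum_nonneg fun _ _ => sq_nonneg _)
    have h3 : ∑ i, ∑ f, u i f ^ 2 = ∑ i, ∑ f, flipAvg x (u i) f ^ 2 +
        ∑ i, ∑ f, flipDiff x (u i) f ^ 2 := by
      rw [← Finset.sum_add_distrib]
      exact Finset.sum_congr rfl fun i _ => (sum_flipAvg_sq_add x (u i)).symm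
    have h4 : ∑ i, ∑ f, flipDiff x (u i) f ^ 2 ≤ A * ∑ f, flipDiff x (u x) f ^ 2 +
        energy W fun i => flipDiff x (u i) := by
      have := Finset.sum_le_sum fun f (_ : f ∈ Finset.univ) =>
        hW (fun i => flipDiff x (u i) f) x
      rw [Finset.sum_add_distrib, ← Finset.mul_sum] at this
      rw [Finset.sum_comm]
      refine this.trans (le_of_eq ?_)
      congr 1
      simp only [energy, Finset.mul_sum]
      rw [Finset.sum_comm]
      refine Finset.sum_congr rfl fun i _ => ?_
      rw [Finset.sum_comm]
    have h5 := energy_flip W x u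
    have h6 := mul_le_mul_of_nonneg_left h2 hA
    simp only [listAvg, List.map_cons, List.sum_cons, mul_add]
    linarith

/-- Poincaré inequality for lamplighter configurations: `z i f` is a function of the cursor position
`i` and the lamps `f : X → ℤ/2`, where lamps are switched only at the cursor. -/
theorem lamplighter_poincare {W : X → X → ℝ} (hW0 : ∀ i j, 0 ≤ W i j) {A : ℝ} (hA : 0 ≤ A)
    (hW : ∀ (v : X → ℝ) (x : X),
      ∑ i, v i ^ 2 ≤ A * v x ^ 2 + ∑ i, ∑ j, W i j * (v i - v j) ^ 2)
    (z : X → (X → ZMod 2) → ℝ) :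
    ∑ i, ∑ f, (z i f - z i (f + 1)) ^ 2 ≤
      A * ∑ x, ∑ f, (z x f - z x (f + Pi.single x 1)) ^ 2 +
      4 * ∑ i, ∑ j, W i j * ∑ f, (z i f - z j f) ^ 2 := by
  have h11 : (1 : X → ZMod 2) + 1 = 0 := by
    funext x
    exact (rfl : (1 : ZMod 2) + 1 = 0)
  have hcomp : ∀ g : (X → ZMod 2) → ℝ, ∑ f, g (f + 1) = ∑ f, g f := fun g =>
    Fintype.sum_equiv (Equiv.addRight (1 : X → ZMod 2)) _ _ fun _ => rfl
  set u : X → (X → ZMod 2) → ℝ := fun i f => z i f - z i (f + 1) with hu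
  have h0 : ∀ i, listAvg Finset.univ.toList (u i) = 0 := fun i =>
    listAvg_univ_eq_zero fun f => by simp only [hu, add_assoc, h11, add_zero]; ring
  have h1 := sum_sq_le_listAvg hA hW Finset.univ.toList u
  simp only [h0] at h1
  have h2 : energy W (fun _ => (0 : (X → ZMod 2) → ℝ)) = 0 := by simp [energy]
  rw [h2] at h1
  simp only [Pi.zero_apply, ne_eq, OfNat.ofNat_ne_zero, not_false_eq_true, zero_pow,
    Finset.sum_const_zero, zero_add, sub_zero, Finset.sum_map_toList] at h1
  refine h1.trans (add_le_add (mul_le_mul_of_nonneg_left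
    (Finset.sum_le_sum fun x _ => ?_) hA) ?_)
  · have e : ∀ f, flipDiff x (u x) f ^ 2 ≤ ((z x f - z x (f + Pi.single x 1)) ^ 2 +
        (z x (f + 1) - z x (f + 1 + Pi.single x 1)) ^ 2) / 2 := by
      intro f
      simp only [flipDiff, hu, add_right_comm f (Pi.single x 1) 1]
      nlinarith [sq_nonneg ((z x f - z x (f + Pi.single x 1)) +
        (z x (f + 1) - z x (f + 1 + Pi.single x 1)))]
    refine (Finset.sum_le_sum fun f _ => e f).trans (le_of_eq ?_)
    have := hcomp fun f => (z x f - z x (f + Pi.single x 1)) ^ 2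
    rw [← Finset.sum_div, Finset.sum_add_distrib, this]
    ring
  · rw [energy, Finset.mul_sum]
    refine Finset.sum_le_sum fun i _ => ?_
    rw [Finset.mul_sum]
    refine Finset.sum_le_sum fun j _ => ?_
    rw [mul_left_comm]
    refine mul_le_mul_of_nonneg_left ?_ (hW0 i j)
    have e : ∀ f, (u i f - u j f) ^ 2 ≤ 2 * (z i f - z j f) ^ 2 +
        2 * (z i (f + 1) - z j (f + 1)) ^ 2 := by
      intro f
      simp only [hu]
      nlinarith [sq_nonneg ((z i f - z j f) + (z i (f + 1) - z j (f + 1)))]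
    refine (Finset.sum_le_sum fun f _ => e f).trans (le_of_eq ?_)
    have := hcomp fun f => (z i f - z j f) ^ 2
    rw [Finset.sum_add_distrib, ← Finset.mul_sum, ← Finset.mul_sum, this]
    ring

end Flips

end Compression

/-! ### Powers of `L_p` distances are of negative type -/

namespace Compression

open MeasureTheory Set

section NegativeType

theorem integrableOn_one_sub_cos {r : ℝ} (hr0 : 0 < r) (hr2 : r < 2) :
    IntegrableOn (fun u : ℝ => (1 - Real.cos u) * u ^ (-1 - r)) (Ioi 0) := by
  rw [← Ioc_union_Ioi_eq_Ioi zero_le_one]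
  have hmeas : ∀ s : Set ℝ, AEStronglyMeasurable
      (fun u : ℝ => (1 - Real.cos u) * u ^ (-1 - r)) (volume.restrict s) := fun s =>
    Measurable.aestronglyMeasurable (by fun_prop)
  refine IntegrableOn.union ?_ ?_
  · have h : IntegrableOn (fun u : ℝ => u ^ (1 - r)) (Ioc 0 1) :=
      (intervalIntegrable_iff_integrableOn_Ioc_of_le zero_le_one).1
        (intervalIntegral.intervalIntegrable_rpow' (by linarith))
    refine h.mono' (hmeas _) ?_
    refine (ae_restrict_iff' measurableSet_Ioc).2 (ae_of_all _ fun u hu => ?_)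
    have h1 : 0 ≤ 1 - Real.cos u := by linarith [Real.cos_le_one u]
    rw [Real.norm_of_nonneg (mul_nonneg h1 (Real.rpow_nonneg hu.1.le _))]
    have h2 : u ^ (1 - r) = u ^ 2 * u ^ (-1 - r) := by
      rw [← Real.rpow_natCast u 2, ← Real.rpow_add hu.1]
      congr 1
      push_cast
      ring
    rw [h2]
    have h3 := Real.one_sub_sq_div_two_le_cos (x := u)
    exact mul_le_mul_of_nonneg_right (by nlinarith [sq_nonneg u]) (Real.rpow_nonneg hu.1.le _)
  · have h : IntegrableOn (fun u : ℝ => 2 * u ^ (-1 - r)) (Ioi 1) :=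
      (integrableOn_Ioi_rpow_of_lt (by linarith) one_pos).const_mul 2
    refine h.mono' (hmeas _) ?_
    refine (ae_restrict_iff' measurableSet_Ioi).2 (ae_of_all _ fun u hu => ?_)
    have hu0 : (0 : ℝ) ≤ u := zero_le_one.trans (le_of_lt hu)
    have h1 : 0 ≤ 1 - Real.cos u := by linarith [Real.cos_le_one u]
    rw [Real.norm_of_nonneg (mul_nonneg h1 (Real.rpow_nonneg hu0 _))]
    exact mul_le_mul_of_nonneg_right (by linarith [Real.neg_one_le_cos u]) (Real.rpow_nonneg hu0 _)

theorem integral_one_sub_cos_pos {r : ℝ} (hr0 : 0 < r) (hr2 : r < 2) :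
    0 < ∫ u in Ioi (0 : ℝ), (1 - Real.cos u) * u ^ (-1 - r) := by
  rw [setIntegral_pos_iff_support_of_nonneg_ae _ (integrableOn_one_sub_cos hr0 hr2)]
  · refine lt_of_lt_of_le ?_ (measure_mono (s := Ioo (0 : ℝ) 1) ?_)
    · simp
    · intro u hu
      refine ⟨?_, hu.1⟩
      have h1 : Real.cos u < 1 := by
        rw [← Real.cos_zero]
        exact Real.cos_lt_cos_of_nonneg_of_le_pi le_rfl
          (hu.2.le.trans (by linarith [Real.pi_gt_three])) hu.1
      exact (mul_pos (by linarith) (Real.rpow_pos_of_pos hu.1 _)).ne'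
  · refine (ae_restrict_iff' measurableSet_Ioi).2 (ae_of_all _ fun u hu => ?_)
    exact mul_nonneg (by linarith [Real.cos_le_one u]) (Real.rpow_nonneg (le_of_lt hu) _)

theorem one_sub_cos_mul_scaled {r : ℝ} {s u : ℝ} (hs : 0 < s) (hu : 0 < u) :
    (1 - Real.cos (s * u)) * u ^ (-1 - r) =
      s ^ (1 + r) * ((1 - Real.cos (s * u)) * (s * u) ^ (-1 - r)) := by
  rw [Real.mul_rpow hs.le hu.le, show (-1 - r) = -(1 + r) by ring, Real.rpow_neg hs.le]
  field_simp

theorem integrableOn_one_sub_cos_mul {r : ℝ} (hr0 : 0 < r) (hr2 : r < 2) (s : ℝ) :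
    IntegrableOn (fun u : ℝ => (1 - Real.cos (s * u)) * u ^ (-1 - r)) (Ioi 0) := by
  rcases eq_or_ne s 0 with rfl | hs
  · simp
  have hs' : 0 < |s| := abs_pos.2 hs
  have hcos : ∀ u, Real.cos (s * u) = Real.cos (|s| * u) := fun u => by
    rcases abs_choice s with h | h <;> simp [h]
  simp only [hcos]
  have h := (integrableOn_Ioi_comp_mul_left_iff
    (fun u : ℝ => (1 - Real.cos u) * u ^ (-1 - r)) 0 hs').2
    (by simpa using integrableOn_one_sub_cos hr0 hr2)
  refine IntegrableOn.congr_fun (h.const_mul (|s| ^ (1 + r))) (fun u hu => ?_) measurableSet_Ioi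
  exact (one_sub_cos_mul_scaled hs' hu).symm

/-- The Lévy–Khintchine representation of `|s| ^ r` for `0 < r < 2`. -/
theorem integral_one_sub_cos_mul {r : ℝ} (hr0 : 0 < r) (s : ℝ) :
    ∫ u in Ioi (0 : ℝ), (1 - Real.cos (s * u)) * u ^ (-1 - r) =
      |s| ^ r * ∫ u in Ioi (0 : ℝ), (1 - Real.cos u) * u ^ (-1 - r) := by
  rcases eq_or_ne s 0 with rfl | hs
  · simp [Real.zero_rpow hr0.ne']
  have hs' : 0 < |s| := abs_pos.2 hs
  have hcos : ∀ u, Real.cos (s * u) = Real.cos (|s| * u) := fun u => by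
    rcases abs_choice s with h | h <;> simp [h]
  simp only [hcos]
  rw [setIntegral_congr_fun measurableSet_Ioi fun u hu => one_sub_cos_mul_scaled hs' hu,
    integral_const_mul, integral_comp_mul_left_Ioi
      (fun u : ℝ => (1 - Real.cos u) * u ^ (-1 - r)) 0 hs', mul_zero, smul_eq_mul, ← mul_assoc]
  congr 1
  rw [add_comm, Real.rpow_add_one hs'.ne', mul_assoc, mul_inv_cancel₀ hs'.ne', mul_one]

variable {ι Ω : Type*} [Fintype ι] {c : ι → ℝ} {a b : ι → Ω}

/-- Schoenberg: a linear inequality between squared distances that holds on the line (equivalently in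
Hilbert space) also holds between `r`-th powers of distances on the line, `0 < r ≤ 2`. -/
theorem sum_abs_rpow_nonneg (H : ∀ z : Ω → ℝ, 0 ≤ ∑ k, c k * (z (a k) - z (b k)) ^ 2) {r : ℝ}
    (hr0 : 0 < r) (hr2 : r ≤ 2) (x : Ω → ℝ) : 0 ≤ ∑ k, c k * |x (a k) - x (b k)| ^ r := by
  rcases hr2.eq_or_lt with rfl | hr2
  · simpa using H x
  have hK := integral_one_sub_cos_pos hr0 hr2
  have hint : ∀ u : ℝ, 0 ≤ ∑ k, c k * (1 - Real.cos ((x (a k) - x (b k)) * u)) := by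
    intro u
    have h1 := H fun w => Real.cos (x w * u)
    have h2 := H fun w => Real.sin (x w * u)
    have h3 : ∑ k, c k * (1 - Real.cos ((x (a k) - x (b k)) * u)) =
        (∑ k, c k * (Real.cos (x (a k) * u) - Real.cos (x (b k) * u)) ^ 2 +
          ∑ k, c k * (Real.sin (x (a k) * u) - Real.sin (x (b k) * u)) ^ 2) / 2 := by
      rw [← Finset.sum_add_distrib, Finset.sum_div]
      refine Finset.sum_congr rfl fun k _ => ?_
      rw [sub_mul, Real.cos_sub]
      have e1 := Real.sin_sq_add_cos_sq (x (a k) * u)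
      have e2 := Real.sin_sq_add_cos_sq (x (b k) * u)
      linear_combination c k / 2 * (-e1 - e2)
    rw [h3]
    linarith
  have h : 0 ≤ ∫ u in Ioi (0 : ℝ),
      ∑ k, c k * ((1 - Real.cos ((x (a k) - x (b k)) * u)) * u ^ (-1 - r)) := by
    refine setIntegral_nonneg measurableSet_Ioi fun u hu => ?_
    simp only [← mul_assoc, ← Finset.sum_mul]
    exact mul_nonneg (hint u) (Real.rpow_nonneg (le_of_lt hu) _)
  rw [integral_finsetSum _ fun k _ =>
    (integrableOn_one_sub_cos_mul hr0 hr2 (x (a k) - x (b k))).integrable.const_mul (c k)] at h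
  simp only [integral_const_mul, integral_one_sub_cos_mul hr0] at h
  simp only [← mul_assoc, ← Finset.sum_mul] at h
  exact nonneg_of_mul_nonneg_left h hK

end NegativeType

section Lp

variable {α : Type*} [MeasurableSpace α] {μ : Measure α} {p : ℝ≥0∞}

theorem Lp_norm_rpow (hp0 : p ≠ 0) (hp : p ≠ ∞) (f : Lp ℝ p μ) :
    ‖f‖ ^ p.toReal = ∫ t, |f t| ^ p.toReal ∂μ := by
  rw [Lp.norm_def, toReal_eLpNorm (Lp.aestronglyMeasurable f),
    lpNorm_eq_integral_norm_rpow_toReal hp0 hp (Lp.aestronglyMeasurable f),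
    ← Real.rpow_mul (integral_nonneg fun t => by positivity),
    inv_mul_cancel₀ (ENNReal.toReal_pos hp0 hp).ne', Real.rpow_one]
  rfl

theorem integrable_abs_rpow (hp0 : p ≠ 0) (hp : p ≠ ∞) (f : Lp ℝ p μ) :
    Integrable (fun t => |f t| ^ p.toReal) μ :=
  (Lp.memLp f).integrable_norm_rpow hp0 hp

/-- A linear inequality between squared distances on the line also holds between `p`-th powers of
distances in `L_p`, `p ≤ 2`. -/
theorem sum_Lp_norm_rpow_nonneg {ι Ω : Type*} [Fintype ι] {c : ι → ℝ} {a b : ι → Ω}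
    (H : ∀ z : Ω → ℝ, 0 ≤ ∑ k, c k * (z (a k) - z (b k)) ^ 2) (hp0 : p ≠ 0) (hp2 : p ≤ 2)
    (v : Ω → Lp ℝ p μ) : 0 ≤ ∑ k, c k * ‖v (a k) - v (b k)‖ ^ p.toReal := by
  have hp : p ≠ ∞ := ne_top_of_le_ne_top (by simp) hp2
  have hr2 : p.toReal ≤ 2 := by simpa using ENNReal.toReal_mono (by simp) hp2
  simp only [Lp_norm_rpow hp0 hp, ← integral_const_mul]
  rw [← integral_finsetSum _ fun k _ => (integrable_abs_rpow hp0 hp _).const_mul _]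
  refine integral_nonneg_of_ae ?_
  have h : ∀ k, ∀ᵐ t ∂μ, (v (a k) - v (b k)) t = v (a k) t - v (b k) t := fun k =>
    Lp.coeFn_sub _ _
  filter_upwards [ae_all_iff.2 h] with t ht
  simp only [ht]
  exact sum_abs_rpow_nonneg H (ENNReal.toReal_pos hp0 hp) hr2 fun w => v w t

end Lp

end Compression

/-! ### The Poincaré inequality in `L_p` -/

namespace Compression

open MeasureTheory

/-- The Poincaré inequality for lamplighter configurations, for maps into `L_p`, `p ≤ 2`. -/
theorem lamplighter_poincare_Lp {α : Type*} [MeasurableSpace α] {μ : Measure α} {p : ℝ≥0∞}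
    (hp0 : p ≠ 0) (hp2 : p ≤ 2) {X : Type*} [DecidableEq X] [Fintype X] {W : X → X → ℝ}
    (hW0 : ∀ i j, 0 ≤ W i j) {A : ℝ} (hA : 0 ≤ A)
    (hW : ∀ (v : X → ℝ) (x : X),
      ∑ i, v i ^ 2 ≤ A * v x ^ 2 + ∑ i, ∑ j, W i j * (v i - v j) ^ 2)
    (v : X → (X → ZMod 2) → Lp ℝ p μ) :
    ∑ i, ∑ f, ‖v i f - v i (f + 1)‖ ^ p.toReal ≤
      A * ∑ x, ∑ f, ‖v x f - v x (f + Pi.single x 1)‖ ^ p.toReal +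
      4 * ∑ i, ∑ j, W i j * ∑ f, ‖v i f - v j f‖ ^ p.toReal := by
  let F := X → ZMod 2
  let ι := (X × F) ⊕ (X × F) ⊕ (X × X × F)
  let c : ι → ℝ := Sum.elim (fun _ => -1) (Sum.elim (fun _ => A) fun k => 4 * W k.1 k.2.1)
  let a : ι → X × F := Sum.elim id (Sum.elim id fun k => (k.1, k.2.2))
  let b : ι → X × F := Sum.elim (fun k => (k.1, k.2 + 1))
    (Sum.elim (fun k => (k.1, k.2 + Pi.single k.1 1)) fun k => (k.2.1, k.2.2))
  have expand : ∀ d : X × F → X × F → ℝ, ∑ k, c k * d (a k) (b k) =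
      A * ∑ x, ∑ f, d (x, f) (x, f + Pi.single x 1) +
      4 * ∑ i, ∑ j, W i j * ∑ f, d (i, f) (j, f) - ∑ i, ∑ f, d (i, f) (i, f + 1) := by
    intro d
    simp only [ι, a, b, c, Fintype.sum_sum_type, Fintype.sum_prod_type, Sum.elim_inl, Sum.elim_inr,
      id_eq, neg_mul, one_mul, Finset.sum_neg_distrib, Finset.mul_sum, mul_assoc]
    ring
  have := sum_Lp_norm_rpow_nonneg (c := c) (a := a) (b := b) (fun z => by
    rw [expand fun s t => (z s - z t) ^ 2]
    linarith [lamplighter_poincare hW0 hA hW fun i f => z (i, f)]) hp0 hp2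
    (fun s : X × F => v s.1 s.2)
  rw [expand fun s t => ‖v s.1 s.2 - v t.1 t.2‖ ^ p.toReal] at this
  linarith

/-- A sum over the distances to a given point of `{0, …, m - 1}`. -/
theorem sum_dist_le (m : ℕ) (i : Fin m) {g : ℕ → ℝ} (hg : ∀ d, 0 ≤ g d) :
    ∑ j : Fin m, g (Nat.dist i j) ≤ 2 * ∑ d ∈ Finset.range m, g d := by
  rw [← Finset.sum_fiberwise_of_maps_to (s := Finset.univ) (t := Finset.range m)
    (g := fun j : Fin m => Nat.dist i j) (by
      intro j _
      have := i.2
      have := j.2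
      simp only [Finset.mem_range, Nat.dist]
      omega), Finset.mul_sum]
  refine Finset.sum_le_sum fun d _ => ?_
  rw [Finset.sum_congr rfl fun j hj => by rw [(Finset.mem_filter.1 hj).2], Finset.sum_const,
    nsmul_eq_mul]
  refine mul_le_mul_of_nonneg_right ?_ (hg d)
  have hinj : ∀ j ∈ Finset.univ.filter (fun j : Fin m => Nat.dist i j = d),
      (j : ℕ) ∈ ({(i : ℕ) - d, i + d} : Finset ℕ) := by
    intro j hj
    have := (Finset.mem_filter.1 hj).2
    simp only [Nat.dist] at this
    simp only [Finset.mem_insert, Finset.mem_singleton]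
    omega
  have := Finset.card_le_card_of_injOn (fun j : Fin m => (j : ℕ)) hinj
    (fun x _ y _ h => Fin.ext h)
  exact_mod_cast this.trans Finset.card_le_two

theorem abs_natCast_sub_natCast (a b : ℕ) : |(a : ℝ) - b| = Nat.dist a b := by
  rcases le_total a b with h | h
  · rw [Nat.dist_eq_sub_of_le h, abs_sub_comm, abs_of_nonneg (by simpa using h), Nat.cast_sub h]
  · rw [Nat.dist_eq_sub_of_le_right h, abs_of_nonneg (by simpa using h), Nat.cast_sub h]

/-- The `p`-cost of the cursor moves is `m ^ r` up to a logarithm. -/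
theorem sum_abs_sub_rpow_le (K : ℕ) {r : ℝ} (hr : 1 ≤ r) :
    ∑ i : Fin (2 ^ K), ∑ j : Fin (2 ^ K),
      |((i : ℕ) : ℝ) - (j : ℕ)| ^ r / (((i : ℕ) : ℝ) - (j : ℕ)) ^ 2 ≤
      2 * (K + 1) * ((2 : ℝ) ^ K) ^ r := by
  set m : ℕ := 2 ^ K with hm
  have hm0 : (0 : ℝ) < m := by positivity
  have hm1 : ((2 : ℝ) ^ K) = m := by rw [hm]; push_cast; rfl
  have hharm : ∑ d ∈ Finset.range m, (d : ℝ) ^ r / (d : ℝ) ^ 2 ≤ (m : ℝ) ^ (r - 1) * (K + 1) := by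
    have h1 : ∀ d ∈ Finset.range m, (d : ℝ) ^ r / (d : ℝ) ^ 2 ≤ (m : ℝ) ^ (r - 1) * (d : ℝ)⁻¹ := by
      intro d hd
      rcases Nat.eq_zero_or_pos d with rfl | hd0
      · simp
      have hd0' : (0 : ℝ) < d := by exact_mod_cast hd0
      have : (d : ℝ) ^ r / (d : ℝ) ^ 2 = (d : ℝ) ^ (r - 1) * (d : ℝ)⁻¹ := by
        rw [Real.rpow_sub_one hd0'.ne']
        field_simp
      rw [this]
      have hdm : (d : ℝ) ≤ m := by exact_mod_cast (Finset.mem_range.1 hd).le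
      gcongr
    refine (Finset.sum_le_sum h1).trans ?_
    rw [← Finset.mul_sum]
    refine mul_le_mul_of_nonneg_left ?_ (by positivity)
    have h2 : ∑ d ∈ Finset.range m, (d : ℝ)⁻¹ ≤ ((harmonic m : ℚ) : ℝ) := by
      rw [harmonic]
      push_cast
      have h5 := Finset.sum_range_succ' (fun d : ℕ => (d : ℝ)⁻¹) m
      have h6 := Finset.sum_range_succ (fun d : ℕ => (d : ℝ)⁻¹) m
      have h7 : (0 : ℝ) ≤ (m : ℝ)⁻¹ := by positivity
      push_cast at h5
      rw [inv_zero, add_zero] at h5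
      linarith
    refine h2.trans ((harmonic_le_one_add_log m).trans ?_)
    rw [← hm1, Real.log_pow]
    have := Real.log_two_lt_d9
    nlinarith [(Nat.cast_nonneg K : (0 : ℝ) ≤ K)]
  have h3 : ∀ i : Fin m, ∑ j : Fin m,
      |((i : ℕ) : ℝ) - (j : ℕ)| ^ r / (((i : ℕ) : ℝ) - (j : ℕ)) ^ 2 ≤
      2 * ((m : ℝ) ^ (r - 1) * (K + 1)) := by
    intro i
    have h4 := sum_dist_le m i (g := fun d => (d : ℝ) ^ r / (d : ℝ) ^ 2) fun d => by positivity
    refine le_trans (le_of_eq ?_) (h4.trans (by linarith))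
    refine Finset.sum_congr rfl fun j _ => ?_
    rw [← sq_abs, abs_natCast_sub_natCast]
  refine (Finset.sum_le_sum fun i _ => h3 i).trans (le_of_eq ?_)
  rw [Finset.sum_const, Finset.card_univ, Fintype.card_fin, nsmul_eq_mul, hm1,
    Real.rpow_sub_one hm0.ne']
  field_simp

end Compression

/-! ### Lamps in two states -/

namespace WreathZ

variable {H : Type*} [Group H]

/-- The configuration with cursor `i` in which the lamps `x ∈ {0, …, m - 1}` with `f x = 1` are in
state `h` and all others are off. -/
def bitConfig (h : H) {m : ℕ} (i : ℤ) (f : Fin m → ZMod 2) : WreathZ H where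
  lamp x := if hx : 0 ≤ x ∧ x < m then (if f ⟨x.toNat, by omega⟩ = 1 then h else 1) else 1
  pos := i
  finite_support := (Set.finite_Ico (0 : ℤ) m).subset fun x hx => by
    by_contra hx'
    rw [Set.mem_Ico] at hx'
    simp [hx'] at hx

@[simp] theorem bitConfig_pos (h : H) {m : ℕ} (i : ℤ) (f : Fin m → ZMod 2) :
    (bitConfig h i f).pos = i := rfl

theorem bitConfig_lamp_of_mem (h : H) {m : ℕ} (i : ℤ) (f : Fin m → ZMod 2) (k : Fin m) :
    (bitConfig h i f).lamp (k : ℕ) = if f k = 1 then h else 1 := by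
  simp [bitConfig]

theorem bitConfig_lamp_of_notMem (h : H) {m : ℕ} (i : ℤ) (f : Fin m → ZMod 2) {x : ℤ}
    (hx : ¬ (0 ≤ x ∧ x < m)) : (bitConfig h i f).lamp x = 1 := by
  simp only [bitConfig, hx, dite_false]

theorem inv_bitConfig_mul_bitConfig_shift (h : H) {m : ℕ} (i j : ℤ) (f : Fin m → ZMod 2) :
    (bitConfig h i f)⁻¹ * bitConfig h j f = shift (j - i) := by
  ext x
  · change ((bitConfig h i f).lamp (x + i))⁻¹ * (bitConfig h i f).lamp (x - -i) = 1
    rw [sub_neg_eq_add, inv_mul_cancel]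
  · simp only [pos_mul, pos_inv, bitConfig_pos, shift_pos]
    ring

theorem zmod_two_eq_zero_of_ne_one {a : ZMod 2} (h : ¬ a = 1) : a = 0 := by
  revert a
  decide

theorem exists_fin_of_mem {m : ℕ} {x : ℤ} (hx : 0 ≤ x ∧ x < m) : ∃ k : Fin m, x = (k : ℕ) :=
  ⟨⟨x.toNat, by omega⟩, by simp [hx.1]⟩

theorem inv_bitConfig_mul_bitConfig_flip (h : H) {m : ℕ} (k : Fin m) (f : Fin m → ZMod 2) :
    (bitConfig h (k : ℕ) f)⁻¹ * bitConfig h (k : ℕ) (f + Pi.single k 1) = lampHom h ∨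
    (bitConfig h (k : ℕ) f)⁻¹ * bitConfig h (k : ℕ) (f + Pi.single k 1) = (lampHom h)⁻¹ := by
  have hoff : ∀ x : ℤ, x ≠ 0 → ((bitConfig h (k : ℕ) f)⁻¹ *
      bitConfig h (k : ℕ) (f + Pi.single k 1)).lamp x = 1 := by
    intro x hx
    simp only [lamp_mul, lamp_inv, pos_inv, bitConfig_pos, sub_neg_eq_add]
    by_cases hm : 0 ≤ x + (k : ℕ) ∧ x + (k : ℕ) < m
    · obtain ⟨l, hl⟩ := exists_fin_of_mem hm
      have hlk : l ≠ k := by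
        rintro rfl
        omega
      rw [hl, bitConfig_lamp_of_mem, bitConfig_lamp_of_mem]
      have hfl : (f + Pi.single k 1 : Fin m → ZMod 2) l = f l := by simp [hlk]
      rw [hfl, inv_mul_cancel]
    · rw [bitConfig_lamp_of_notMem _ _ _ hm, bitConfig_lamp_of_notMem _ _ _ hm]
      simp
  have h0 : ((bitConfig h (k : ℕ) f)⁻¹ * bitConfig h (k : ℕ) (f + Pi.single k 1)).lamp 0 =
      (if f k = 1 then h else 1)⁻¹ * if f k + 1 = 1 then h else 1 := by
    simp only [lamp_mul, lamp_inv, pos_inv, bitConfig_pos, sub_neg_eq_add, zero_add,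
      bitConfig_lamp_of_mem, Pi.add_apply, Pi.single_eq_same]
  by_cases hf : f k = 1
  · right
    ext x
    · rcases eq_or_ne x 0 with rfl | hx
      · rw [h0]
        simp [hf]
      · rw [hoff x hx]
        simp [hx]
    · simp
  · left
    ext x
    · rcases eq_or_ne x 0 with rfl | hx
      · rw [h0]
        simp [zmod_two_eq_zero_of_ne_one hf]
      · rw [hoff x hx]
        simp [hx]
    · simp

open Compression

theorem lampLength_bitConfig {S : Set H} (hS : Subgroup.closure S = ⊤) (h : H) {m : ℕ} (i : ℤ)
    (f : Fin m → ZMod 2) :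
    ∑ᶠ x, (wordLength S (((bitConfig h i f)⁻¹ * bitConfig h i (f + 1)).lamp x) : ℝ) =
      m * wordLength S h := by
  have e : ∀ x, (wordLength S (((bitConfig h i f)⁻¹ * bitConfig h i (f + 1)).lamp x) : ℝ) =
      if 0 ≤ x + i ∧ x + i < m then (wordLength S h : ℝ) else 0 := by
    intro x
    simp only [lamp_mul, lamp_inv, pos_inv, bitConfig_pos, sub_neg_eq_add]
    by_cases hm : 0 ≤ x + i ∧ x + i < m
    · obtain ⟨l, hl⟩ := exists_fin_of_mem hm
      rw [if_pos hm, hl, bitConfig_lamp_of_mem, bitConfig_lamp_of_mem, Pi.add_apply, Pi.one_apply]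
      by_cases hf : f l = 1
      · simp [hf, wordLength_inv hS]
      · simp [zmod_two_eq_zero_of_ne_one hf]
    · rw [bitConfig_lamp_of_notMem _ _ _ hm, bitConfig_lamp_of_notMem _ _ _ hm, if_neg hm]
      simp [wordLength_one]
  rw [finsum_congr e]
  refine (finsum_comp_equiv (Equiv.addRight i)
    (f := fun x => if 0 ≤ x ∧ x < (m : ℤ) then (wordLength S h : ℝ) else 0)).trans ?_
  rw [finsum_eq_sum_of_support_subset (s := Finset.Ico (0 : ℤ) m)]
  · rw [Finset.sum_congr rfl fun x hx => if_pos (Finset.mem_Ico.1 hx)]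
    simp
  · intro x hx
    rw [Finset.coe_Ico, Set.mem_Ico]
    by_contra hx'
    simp [hx'] at hx

theorem lampLength_lampHom (S : Set H) (h : H) :
    ∑ᶠ x, (wordLength S ((lampHom h).lamp x) : ℝ) = wordLength S h := by
  rw [finsum_eq_single _ 0 (fun x hx => by simp [hx, wordLength_one])]
  simp

end WreathZ

namespace Compression

open MeasureTheory WreathZ

variable {H : Type*} [Group H] {S : Set H} {T : Set (WreathZ H)} {X : Type*}
  [NormedAddCommGroup X] [NormedSpace ℝ X]

theorem IsEquivariant.comp_hom {G G' : Type*} [Group G] [Group G'] {Ψ : G → X}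
    (h : IsEquivariant Ψ) (φ : G' →* G) : IsEquivariant fun g => Ψ (φ g) := by
  obtain ⟨τ, v, hv⟩ := h
  exact ⟨τ.comp φ, v, fun g => hv _⟩

theorem lampHom_injective : Function.Injective (lampHom : H →* WreathZ H) := fun a b h => by
  simpa using congrArg (fun g => g.lamp 0) h

theorem exists_lampLength_rpow_le (hS : Subgroup.closure S = ⊤) (hTfin : T.Finite)
    (hT : Subgroup.closure T = ⊤) {β : ℝ} (hβ : 0 ≤ β) {Y : Type*}
    [NormedAddCommGroup Y] {Ψ : WreathZ H → Y} {c : ℝ} (hc : 0 < c)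
    (h : ∀ g : WreathZ H, g ≠ 1 → c * (wordLength T g : ℝ) ^ β ≤ ‖Ψ g - Ψ 1‖) :
    ∃ c' : ℝ, 0 < c' ∧ ∀ g : WreathZ H, g ≠ 1 →
      c' * (∑ᶠ x, (wordLength S (g.lamp x) : ℝ)) ^ β ≤ ‖Ψ g - Ψ 1‖ := by
  obtain ⟨M, hM0, hM⟩ := exists_lampLength_le hS hTfin hT
  refine ⟨c / M ^ β, by positivity, fun g hg => le_trans ?_ (h g hg)⟩
  have h1 : (∑ᶠ x, (wordLength S (g.lamp x) : ℝ)) ^ β ≤ (M * wordLength T g) ^ β :=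
    Real.rpow_le_rpow (finsum_nonneg fun x => by positivity) (hM g) hβ
  rw [Real.mul_rpow hM0.le (by positivity)] at h1
  rw [div_mul_eq_mul_div, div_le_iff₀ (by positivity)]
  nlinarith

/-- The lamp group is undistorted. -/
theorem Admissible.of_wreath (hS : Subgroup.closure S = ⊤) (hTfin : T.Finite)
    (hT : Subgroup.closure T = ⊤) {β : ℝ} (hβ : 0 ≤ β) (h : Admissible T X β) :
    Admissible S X β := by
  obtain ⟨Ψ, hΨ, c, hc, h⟩ := h
  obtain ⟨c', hc', h'⟩ := exists_lampLength_rpow_le hS hTfin hT hβ hc h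
  refine ⟨fun g => Ψ (lampHom g), hΨ.comp_hom lampHom, c', hc', fun g hg => ?_⟩
  have := h' (lampHom g) (fun h1 => hg (lampHom_injective (by rw [h1, map_one])))
  rw [lampLength_lampHom] at this
  simpa using this

/-- The Poincaré inequality applied to `m = 2 ^ K` lamps, each off or in state `a`: up to powers of
`K`, some element of length at least `m |a|` has displacement `≲ m + m ^ (1 / r) N(a)`, where `N(a)`
is the displacement of `a` in the lamp at `0`. -/
theorem rpow_le_of_poincare {α : Type*} [MeasurableSpace α] {μ : Measure α} {p : ℝ≥0∞}
    [Fact (1 ≤ p)] (hp2 : p ≤ 2) (hS : Subgroup.closure S = ⊤)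
    {Ψ : WreathZ H → Lp ℝ p μ} (hΨ : IsEquivariant Ψ) {c β : ℝ} (hc : 0 < c)
    (h : ∀ g : WreathZ H, g ≠ 1 →
      c * (∑ᶠ x, (wordLength S (g.lamp x) : ℝ)) ^ β ≤ ‖Ψ g - Ψ 1‖) (K : ℕ) (a : H) (ha : a ≠ 1) :
    (c * (2 ^ K * wordLength S a : ℝ) ^ β) ^ p.toReal ≤
      2 * 2 ^ K * ‖Ψ (lampHom a) - Ψ 1‖ ^ p.toReal +
      48 * ‖Ψ (shift 1) - Ψ 1‖ ^ p.toReal * (K ^ 2 * (K + 1)) * ((2 : ℝ) ^ K) ^ p.toReal := by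
  have hp1 : 1 ≤ p := Fact.out
  have hp : p ≠ ∞ := ne_top_of_le_ne_top (by simp) hp2
  set r := p.toReal with hr
  have hr1 : 1 ≤ r := by simpa using ENNReal.toReal_mono hp hp1
  have hr0 : 0 ≤ r := by linarith
  set m : ℕ := 2 ^ K with hm
  have hm1 : ((2 : ℝ) ^ K) = m := by rw [hm]; push_cast; rfl
  have hm0 : (0 : ℝ) < m := by positivity
  set N : WreathZ H → ℝ := fun g => ‖Ψ g - Ψ 1‖ with hN
  have hNn : ∀ g, 0 ≤ N g := fun g => norm_nonneg _
  have hshift : ∀ i : ℤ, N (shift i) ≤ N (shift 1) * |(i : ℝ)| := by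
    refine length_shift_le (ℓ := N) (by simp [hN]) hΨ.norm_mul_le ⟨le_rfl, ?_⟩
    have := hΨ.norm_inv (shift 1)
    rw [shift_inv] at this
    exact this.le
  let W : Fin m → Fin m → ℝ := fun i j => 6 * K ^ 2 * 2 ^ K / (((i : ℕ) : ℝ) - (j : ℕ)) ^ 2
  have key := lamplighter_poincare_Lp (μ := μ) (p := p) (by positivity) hp2 (X := Fin m) (W := W)
    (A := 2 * 2 ^ K) (fun i j => by positivity) (by positivity) (sum_sq_le_energy K)
    (fun i f => Ψ (bitConfig a (i : ℕ) f))
  simp only [hΨ.norm_sub (bitConfig _ _ _), ← hr, inv_bitConfig_mul_bitConfig_shift] at key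
  set F : ℝ := (Fintype.card (Fin m → ZMod 2) : ℝ) with hF
  have hF0 : 0 < F := by
    rw [hF]
    exact_mod_cast Fintype.card_pos
  -- antipodal configurations
  have e1 : m * F * (c * (m * wordLength S a : ℝ) ^ β) ^ r ≤ ∑ i : Fin m, ∑ f : Fin m → ZMod 2,
      ‖Ψ ((bitConfig a (i : ℕ) f)⁻¹ * bitConfig a (i : ℕ) (f + 1)) - Ψ 1‖ ^ r := by
    have : ∀ (i : Fin m) (f : Fin m → ZMod 2), (c * (m * wordLength S a : ℝ) ^ β) ^ r ≤
        ‖Ψ ((bitConfig a (i : ℕ) f)⁻¹ * bitConfig a (i : ℕ) (f + 1)) - Ψ 1‖ ^ r := by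
      intro i f
      refine Real.rpow_le_rpow (by positivity) ?_ hr0
      have hl := lampLength_bitConfig hS a (i : ℕ) f
      rw [← hl]
      refine h _ fun h1 => ?_
      rw [h1] at hl
      have hpos : (0 : ℝ) < m * wordLength S a :=
        mul_pos hm0 (by exact_mod_cast one_le_wordLength hS ha)
      rw [← hl] at hpos
      simp [wordLength_one] at hpos
    refine le_trans (le_of_eq ?_) (Finset.sum_le_sum fun i _ => Finset.sum_le_sum fun f _ =>
      this i f)
    simp only [Finset.sum_const, Finset.card_univ, Fintype.card_fin, nsmul_eq_mul, hF]
    ring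
  -- switching the lamp at the cursor
  have e2 : ∑ x : Fin m, ∑ f : Fin m → ZMod 2,
      ‖Ψ ((bitConfig a (x : ℕ) f)⁻¹ * bitConfig a (x : ℕ) (f + Pi.single x 1)) - Ψ 1‖ ^ r =
      m * F * N (lampHom a) ^ r := by
    have : ∀ (x : Fin m) (f : Fin m → ZMod 2),
        ‖Ψ ((bitConfig a (x : ℕ) f)⁻¹ * bitConfig a (x : ℕ) (f + Pi.single x 1)) - Ψ 1‖ ^ r =
        N (lampHom a) ^ r := by
      intro x f
      rcases inv_bitConfig_mul_bitConfig_flip a x f with h1 | h1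
      · rw [h1]
      · rw [h1, hΨ.norm_inv]
    simp only [this, Finset.sum_const, Finset.card_univ, Fintype.card_fin, nsmul_eq_mul, hF]
    ring
  -- moving the cursor
  have e3 : ∑ i : Fin m, ∑ j : Fin m, W i j * ∑ _f : Fin m → ZMod 2,
      ‖Ψ (shift (((j : ℕ) : ℤ) - (i : ℕ))) - Ψ 1‖ ^ r ≤
      F * (6 * K ^ 2 * m * N (shift 1) ^ r * (2 * (K + 1) * (m : ℝ) ^ r)) := by
    have h1 : ∀ i j : Fin m, W i j * ∑ _f : Fin m → ZMod 2,
        ‖Ψ (shift (((j : ℕ) : ℤ) - (i : ℕ))) - Ψ 1‖ ^ r ≤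
        F * (6 * K ^ 2 * m * N (shift 1) ^ r) *
          (|((i : ℕ) : ℝ) - (j : ℕ)| ^ r / (((i : ℕ) : ℝ) - (j : ℕ)) ^ 2) := by
      intro i j
      have h2 : ‖Ψ (shift (((j : ℕ) : ℤ) - (i : ℕ))) - Ψ 1‖ ^ r ≤
          N (shift 1) ^ r * |((i : ℕ) : ℝ) - (j : ℕ)| ^ r := by
        rw [← Real.mul_rpow (hNn _) (abs_nonneg _), abs_sub_comm]
        refine Real.rpow_le_rpow (norm_nonneg _) ?_ hr0
        have := hshift (((j : ℕ) : ℤ) - (i : ℕ))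
        push_cast at this
        exact this
      rw [Finset.sum_const, Finset.card_univ, nsmul_eq_mul]
      have hW0 : 0 ≤ W i j * F := by positivity
      calc W i j * (F * ‖Ψ (shift (((j : ℕ) : ℤ) - (i : ℕ))) - Ψ 1‖ ^ r)
          = W i j * F * ‖Ψ (shift (((j : ℕ) : ℤ) - (i : ℕ))) - Ψ 1‖ ^ r := by ring
        _ ≤ W i j * F * (N (shift 1) ^ r * |((i : ℕ) : ℝ) - (j : ℕ)| ^ r) := by gcongr
        _ = _ := by
          simp only [W, hm1]
          ring
    refine (Finset.sum_le_sum fun i _ => Finset.sum_le_sum fun j _ => h1 i j).trans ?_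
    simp only [← Finset.mul_sum]
    have h4 := sum_abs_sub_rpow_le K hr1
    rw [hm1] at h4
    calc _ ≤ F * (6 * K ^ 2 * m * N (shift 1) ^ r) * (2 * (K + 1) * (m : ℝ) ^ r) := by
          refine mul_le_mul_of_nonneg_left h4 ?_
          have := Real.rpow_nonneg (hNn (shift 1)) r
          positivity
      _ = _ := by ring
  rw [e2] at key
  rw [hm1] at key ⊢
  have h5 : m * F * (c * (m * wordLength S a : ℝ) ^ β) ^ r ≤ m * F *
      (2 * m * N (lampHom a) ^ r + 48 * N (shift 1) ^ r * (K ^ 2 * (K + 1)) * (m : ℝ) ^ r) := by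
    refine e1.trans (key.trans ?_)
    calc _ ≤ 2 * m * (m * F * N (lampHom a) ^ r) +
          4 * (F * (6 * K ^ 2 * m * N (shift 1) ^ r * (2 * (K + 1) * (m : ℝ) ^ r))) := by gcongr
      _ = _ := by ring
  exact le_of_mul_le_mul_left h5 (by positivity)

end Compression

/-! ### The upper bound -/

namespace Compression

open MeasureTheory WreathZ

/-- A cubic polynomial in `K` does not dominate a positive power of `2 ^ K` for large `K`. -/
theorem exists_lt_two_pow_rpow {c D e : ℝ} (hc : 0 < c) (hD : 0 < D) (he : 0 < e) :
    ∃ K₀ : ℕ, ∀ K ≥ K₀, D * (K + 1 : ℝ) ^ 3 < c * ((2 : ℝ) ^ K) ^ e := by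
  set ρ : ℝ := 2 ^ e with hρ
  have hρ1 : 1 < ρ := Real.one_lt_rpow (by norm_num) he
  have hlim := tendsto_pow_const_div_const_pow_of_one_lt 3 hρ1
  have hpos : 0 < c / (D * ρ) := by positivity
  obtain ⟨K₀, hK₀⟩ := Filter.eventually_atTop.1 (hlim.eventually (gt_mem_nhds hpos))
  refine ⟨K₀, fun K hK => ?_⟩
  have h := hK₀ (K + 1) (by omega)
  rw [div_lt_div_iff₀ (by positivity) (by positivity), pow_succ ρ] at h
  have h1 : ((2 : ℝ) ^ K) ^ e = ρ ^ K := by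
    rw [hρ, ← Real.rpow_natCast, ← Real.rpow_mul (by norm_num), mul_comm, Real.rpow_mul (by norm_num),
      Real.rpow_natCast]
  rw [h1]
  push_cast at h
  have h2 : (D * (K + 1 : ℝ) ^ 3) * ρ < (c * ρ ^ K) * ρ := by linarith
  exact lt_of_mul_lt_mul_right h2 (by linarith)

variable {H : Type*} [Group H] {S : Set H} {T : Set (WreathZ H)}

/-- If `α` is not admissible for `H` then there are arbitrarily long elements of `H` whose
displacement is at most `|a| ^ α`. -/
theorem exists_long_of_not_admissible {X : Type*} [NormedAddCommGroup X] [NormedSpace ℝ X]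
    {α : ℝ} (hα : 0 < α) (h : ¬ Admissible S X α) {Ψ : H → X} (hΨ : IsEquivariant Ψ) {c : ℝ}
    (hc : 0 < c) (hlow : ∀ a, a ≠ 1 → c ≤ ‖Ψ a - Ψ 1‖) (R : ℝ) :
    ∃ a : H, a ≠ 1 ∧ R < wordLength S a ∧ ‖Ψ a - Ψ 1‖ ≤ (wordLength S a : ℝ) ^ α := by
  set R' := max R 1
  have hR' : 0 < R' := by positivity
  set ε := min 1 (c / R' ^ α)
  have hε : 0 < ε := by positivity
  have : ∃ a : H, a ≠ 1 ∧ ‖Ψ a - Ψ 1‖ < ε * (wordLength S a : ℝ) ^ α := by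
    by_contra! hcon
    exact h ⟨Ψ, hΨ, ε, hε, hcon⟩
  obtain ⟨a, ha, hlt⟩ := this
  refine ⟨a, ha, ?_, hlt.le.trans ?_⟩
  · have h1 := (hlow a ha).trans_lt hlt
    have h2 : ε * (wordLength S a : ℝ) ^ α ≤ c / R' ^ α * (wordLength S a : ℝ) ^ α := by
      gcongr
      exact min_le_right _ _
    have h3 := h1.trans_le h2
    rw [div_mul_eq_mul_div, lt_div_iff₀ (by positivity)] at h3
    have h4 := lt_of_mul_lt_mul_left h3 hc.le
    exact (le_max_left _ _).trans_lt ((Real.rpow_lt_rpow_iff (by positivity) (by positivity) hα).1 h4)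
  · have h5 : (0 : ℝ) ≤ (wordLength S a : ℝ) ^ α := by positivity
    nlinarith [min_le_left 1 (c / R' ^ α)]

/-- The upper bound `β ≤ α / (α + (1 - 1 / p))` on the exponent of the wreath product, for every
`α` that `H` does not admit. -/
theorem Admissible.mul_le_of_not_admissible {Ω : Type*} [MeasurableSpace Ω] {μ : Measure Ω}
    {p : ℝ≥0∞} [Fact (1 ≤ p)] (hp1 : 1 < p) (hp2 : p ≤ 2) (hS : Subgroup.closure S = ⊤)
    (hTfin : T.Finite) (hT : Subgroup.closure T = ⊤) {β : ℝ} (hβ : 0 ≤ β)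
    (h : Admissible T (Lp ℝ p μ) β) {α : ℝ} (hα : 0 < α) (hnot : ¬ Admissible S (Lp ℝ p μ) α) :
    β * (α + (1 - p.toReal⁻¹)) ≤ α := by
  have hp : p ≠ ∞ := ne_top_of_le_ne_top (by simp) hp2
  obtain ⟨Ψ, hΨ, c₀, hc₀, hlow₀⟩ := h
  obtain ⟨c, hc, hlow⟩ := exists_lampLength_rpow_le hS hTfin hT hβ hc₀ hlow₀
  have key := rpow_le_of_poincare hp2 hS hΨ hc hlow
  set r := p.toReal with hr
  have hr1 : 1 < r := by
    have := (ENNReal.toReal_lt_toReal (by simp) hp).2 hp1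
    simpa using this
  have hr0 : 0 < r := by linarith
  have hr10 : 0 < r - 1 := by linarith
  set C := ‖Ψ (shift 1) - Ψ 1‖ ^ r with hC
  have hC0 : 0 ≤ C := by positivity
  have hΨ' : IsEquivariant fun a : H => Ψ (lampHom a) := hΨ.comp_hom lampHom
  have hlow' : ∀ a : H, a ≠ 1 → c ≤ ‖Ψ (lampHom a) - Ψ (lampHom 1)‖ := by
    intro a ha
    have h1 := hlow (lampHom a) (fun h1 => ha (lampHom_injective (by rw [h1, map_one])))
    rw [lampLength_lampHom] at h1
    have h2 : (1 : ℝ) ≤ (wordLength S a : ℝ) ^ β :=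
      Real.one_le_rpow (by exact_mod_cast one_le_wordLength hS ha) hβ
    rw [map_one]
    nlinarith
  -- the number of lamps is `2 ^ K ≈ n ^ s`, where `n` is the length of the lamp state
  set s := α * r / (r - 1) with hs
  have hs0 : 0 < s := by positivity
  set e := β * (1 + 1 / s) with he
  suffices hle : e ≤ 1 by
    have h1 : β * (α + (1 - r⁻¹)) = e * α := by
      rw [he, hs]
      field_simp
    rw [h1]
    nlinarith
  by_contra! hgt
  set c' := c * (2 : ℝ) ^ (-(β / s)) with hc'
  have hc'0 : 0 < c' := by positivity
  obtain ⟨K₀, hK₀⟩ := exists_lt_two_pow_rpow (c := c' ^ r) (D := 2 + 48 * C)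
    (e := (e - 1) * r) (by positivity) (by positivity) (mul_pos (by linarith) hr0)
  obtain ⟨a, ha, hRa, hNa⟩ := exists_long_of_not_admissible hα hnot hΨ' hc hlow'
    ((2 : ℝ) ^ ((K₀ : ℝ) / s))
  rw [map_one] at hNa
  set n : ℝ := (wordLength S a : ℝ) with hn
  have hn1 : 1 ≤ n := by
    rw [hn]
    exact_mod_cast one_le_wordLength hS ha
  have hn0 : 0 < n := by linarith
  have hns : 1 ≤ n ^ s := Real.one_le_rpow hn1 hs0.le
  set K := ⌈Real.logb 2 (n ^ s)⌉₊ with hK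
  set m : ℝ := 2 ^ K with hm
  have hm0 : 0 < m := by positivity
  have hm1 : n ^ s ≤ m := by
    rw [hm, ← Real.rpow_natCast, ← Real.logb_le_iff_le_rpow (by norm_num) (by positivity)]
    exact Nat.le_ceil _
  have hm2 : m ≤ 2 * n ^ s := by
    have h1 : (K : ℝ) < Real.logb 2 (n ^ s) + 1 :=
      Nat.ceil_lt_add_one (Real.logb_nonneg (by norm_num) hns)
    have h2 : (2 : ℝ) ^ (K : ℝ) ≤ 2 ^ (Real.logb 2 (n ^ s) + 1) :=
      Real.rpow_le_rpow_of_exponent_le (by norm_num) h1.le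
    rw [Real.rpow_add_one (by norm_num), Real.rpow_logb (by norm_num) (by norm_num) (by positivity),
      Real.rpow_natCast] at h2
    linarith
  have hKK₀ : K₀ ≤ K := by
    have h1 : (2 : ℝ) ^ (K₀ : ℝ) ≤ 2 ^ (K : ℝ) := by
      rw [Real.rpow_natCast (2 : ℝ) K, ← hm]
      refine le_trans ?_ hm1
      have h2 : ((2 : ℝ) ^ ((K₀ : ℝ) / s)) ^ s ≤ n ^ s :=
        Real.rpow_le_rpow (by positivity) hRa.le hs0.le
      rwa [← Real.rpow_mul (by norm_num), div_mul_cancel₀ _ hs0.ne'] at h2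
    exact_mod_cast (Real.rpow_le_rpow_left_iff (by norm_num)).1 h1
  have h1 := key K a ha
  rw [← hm, ← hn] at h1
  -- the switching term
  have h2 : 2 * m * ‖Ψ (lampHom a) - Ψ 1‖ ^ r ≤ 2 * m ^ r := by
    have h3 : ‖Ψ (lampHom a) - Ψ 1‖ ^ r ≤ m ^ (r - 1) := by
      calc ‖Ψ (lampHom a) - Ψ 1‖ ^ r ≤ (n ^ α) ^ r :=
            Real.rpow_le_rpow (norm_nonneg _) hNa hr0.le
        _ = (n ^ s) ^ (r - 1) := by
            rw [← Real.rpow_mul hn0.le, ← Real.rpow_mul hn0.le, hs, div_mul_cancel₀ _ hr10.ne']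
        _ ≤ m ^ (r - 1) := Real.rpow_le_rpow (by positivity) hm1 hr10.le
    rw [Real.rpow_sub_one hm0.ne'] at h3
    calc 2 * m * ‖Ψ (lampHom a) - Ψ 1‖ ^ r ≤ 2 * m * (m ^ r / m) := by gcongr
      _ = 2 * m ^ r := by field_simp
  have h4 : (K : ℝ) ^ 2 * (K + 1) ≤ (K + 1) ^ 3 := by
    have : (0 : ℝ) ≤ K := by positivity
    nlinarith
  have h5 : (2 : ℝ) ≤ 2 * (K + 1) ^ 3 := by
    have : (1 : ℝ) ≤ (K + 1) ^ 3 := one_le_pow₀ (by simp)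
    linarith
  have h6 : (c * (m * n) ^ β) ^ r ≤ (2 + 48 * C) * (K + 1) ^ 3 * m ^ r := by
    refine h1.trans ?_
    have h7 : 48 * C * ((K : ℝ) ^ 2 * (K + 1)) ≤ 48 * C * (K + 1) ^ 3 := by gcongr
    have h8 : 0 ≤ m ^ r := by positivity
    nlinarith
  -- the length term
  have h9 : c' * m ^ e ≤ c * (m * n) ^ β := by
    have h10 : (m / 2) ^ (1 / s) ≤ n := by
      have h11 : (m / 2) ^ (1 / s) ≤ (n ^ s) ^ (1 / s) :=
        Real.rpow_le_rpow (by positivity) (by linarith) (by positivity)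
      rwa [← Real.rpow_mul hn0.le, mul_one_div_cancel hs0.ne', Real.rpow_one] at h11
    have h12 : (m * (m / 2) ^ (1 / s)) ^ β ≤ (m * n) ^ β :=
      Real.rpow_le_rpow (by positivity) (by gcongr) hβ
    have h13 : (m * (m / 2) ^ (1 / s)) ^ β = (2 : ℝ) ^ (-(β / s)) * m ^ e := by
      rw [Real.div_rpow hm0.le (by norm_num), ← mul_div_assoc, ← Real.rpow_one_add' hm0.le
        (by positivity), Real.div_rpow (by positivity) (by positivity), ← Real.rpow_mul hm0.le,
        ← Real.rpow_mul (by norm_num), Real.rpow_neg (by norm_num), he]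
      rw [show 1 / s * β = β / s by ring, show (1 + 1 / s) * β = β * (1 + 1 / s) by ring]
      field_simp
    rw [hc', mul_assoc, ← h13]
    gcongr
  have h14 : (c' * m ^ e) ^ r ≤ (2 + 48 * C) * (K + 1) ^ 3 * m ^ r :=
    (Real.rpow_le_rpow (by positivity) h9 hr0.le).trans h6
  have h15 : (c' * m ^ e) ^ r = c' ^ r * m ^ ((e - 1) * r) * m ^ r := by
    rw [Real.mul_rpow hc'0.le (by positivity), ← Real.rpow_mul hm0.le, mul_assoc (c' ^ r),
      ← Real.rpow_add hm0]
    congr 2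
    ring
  rw [h15] at h14
  have h16 := le_of_mul_le_mul_right h14 (by positivity)
  exact absurd (hK₀ K hKK₀) (not_lt.2 h16)

end Compression

/-! ### Affine isometric actions on `ℓ_p` sums of copies of `L_p([0,1])` -/

namespace Compression

open MeasureTheory Set

section Orbit

variable {G : Type*} [Group G] {J : Type*} {E : Type*} [NormedAddCommGroup E] [NormedSpace ℝ E]
  {p : ℝ≥0∞} [Fact (1 ≤ p)]

theorem memℓp_sub_of_reindex {F : Type*} [NormedAddCommGroup F] (hp : p ≠ ∞)
    {ξ η ξ' η' : J → F} (σ : Equiv.Perm J)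
    (h : ∀ j, ‖ξ j - η j‖ = ‖ξ' (σ j) - η' (σ j)‖) (hmem : Memℓp (ξ' - η') p) :
    Memℓp (ξ - η) p := by
  have hr0 : 0 < p.toReal := ENNReal.toReal_pos (zero_lt_one.trans_le Fact.out).ne' hp
  rw [memℓp_gen_iff hr0] at hmem ⊢
  simp only [Pi.sub_apply, h] at hmem ⊢
  exact (Equiv.summable_iff σ (f := fun j => ‖ξ' j - η' j‖ ^ p.toReal)).2 hmem

/-- An action on functions `J → E` which is, up to a permutation of the coordinates, isometric in each
coordinate, and a base point `ξ₀`, not necessarily `p`-summable, which is moved by `p`-summable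
amounts, give an action by affine isometries on `E` as soon as `ℓ_p(J; E) ≃ E`. -/
theorem exists_isEquivariant_of_action (hp : p ≠ ∞) (Φ : lp (fun _ : J => E) p ≃ₗᵢ[ℝ] E)
    (act : G → (J → E) → J → E) (h1 : ∀ ξ, act 1 ξ = ξ)
    (hmul : ∀ g h ξ, act (g * h) ξ = act g (act h ξ))
    (hiso : ∀ g, ∃ σ : Equiv.Perm J, ∀ ξ η j, ‖act g ξ j - act g η j‖ = ‖ξ (σ j) - η (σ j)‖)
    (ξ₀ : J → E) (hξ₀ : ∀ g, Memℓp (act g ξ₀ - ξ₀) p) :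
    ∃ Ψ : G → E, IsEquivariant Ψ ∧
      ∀ g, HasSum (fun j => ‖act g ξ₀ j - ξ₀ j‖ ^ p.toReal) (‖Ψ g - Ψ 1‖ ^ p.toReal) := by
  have hr0 : 0 < p.toReal := ENNReal.toReal_pos (zero_lt_one.trans_le Fact.out).ne' hp
  have hmem : ∀ g (v : lp (fun _ : J => E) p), Memℓp (act g (ξ₀ + ⇑v) - ξ₀) p := by
    intro g v
    obtain ⟨σ, hσ⟩ := hiso g
    have e : act g (ξ₀ + ⇑v) - ξ₀ = (act g (ξ₀ + ⇑v) - act g ξ₀) + (act g ξ₀ - ξ₀) := by abel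
    rw [e]
    refine Memℓp.add (memℓp_sub_of_reindex hp σ (hσ _ _) ?_) (hξ₀ g)
    rw [add_sub_cancel_left]
    exact lp.memℓp v
  let T : G → lp (fun _ : J => E) p → lp (fun _ : J => E) p := fun g v =>
    ⟨act g (ξ₀ + ⇑v) - ξ₀, hmem g v⟩
  have hT : ∀ g v, ⇑(T g v) = act g (ξ₀ + ⇑v) - ξ₀ := fun _ _ => rfl
  have hT1 : ∀ v, T 1 v = v := fun v => lp.ext (by rw [hT, h1, add_sub_cancel_left])
  have hTmul : ∀ g h v, T (g * h) v = T g (T h v) := fun g h v => lp.ext (by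
    rw [hT, hT, hT, hmul, add_sub_cancel])
  have hTiso : ∀ g, Isometry (T g) := by
    intro g
    refine Isometry.of_dist_eq fun v w => ?_
    obtain ⟨σ, hσ⟩ := hiso g
    rw [dist_eq_norm, dist_eq_norm, lp.norm_eq_tsum_rpow hr0, lp.norm_eq_tsum_rpow hr0]
    congr 1
    refine Eq.trans (tsum_congr fun j => ?_)
      (Equiv.tsum_eq σ fun j => ‖(⇑(v - w) : J → E) j‖ ^ p.toReal)
    rw [lp.coeFn_sub, lp.coeFn_sub, Pi.sub_apply, Pi.sub_apply, hT, hT, Pi.sub_apply, Pi.sub_apply,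
      sub_sub_sub_cancel_right, hσ]
    simp
  let I : G → (lp (fun _ : J => E) p ≃ᵢ lp (fun _ : J => E) p) := fun g =>
    { toFun := T g
      invFun := T g⁻¹
      left_inv := fun v => by rw [← hTmul, inv_mul_cancel, hT1]
      right_inv := fun v => by rw [← hTmul, mul_inv_cancel, hT1]
      isometry_toFun := hTiso g }
  let τ : G →* (E ≃ᵃⁱ[ℝ] E) :=
    { toFun := fun g => ((Φ.symm.toIsometryEquiv.trans (I g)).trans
        Φ.toIsometryEquiv).toRealAffineIsometryEquiv
      map_one' := by
        ext v
        change Φ (T 1 (Φ.symm v)) = v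
        rw [hT1, Φ.apply_symm_apply]
      map_mul' := fun g h => by
        ext v
        change Φ (T (g * h) (Φ.symm v)) = Φ (T g (Φ.symm (Φ (T h (Φ.symm v)))))
        rw [Φ.symm_apply_apply, hTmul] }
  have hτ : ∀ g, τ g 0 = Φ (T g 0) := fun g => by
    change Φ (T g (Φ.symm 0)) = _
    rw [map_zero]
  refine ⟨fun g => τ g 0, ⟨τ, 0, fun _ => rfl⟩, fun g => ?_⟩
  change HasSum _ (‖τ g 0 - τ 1 0‖ ^ p.toReal)
  rw [hτ, hτ, hT1, map_zero, sub_zero, Φ.norm_map]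
  have := lp.hasSum_norm hr0 (T g 0)
  simpa only [hT, lp.coeFn_zero, add_zero, Pi.sub_apply] using this

end Orbit

section Selfsimilar

variable {Ω : Type*} [MeasurableSpace Ω] {μ : Measure Ω} {p : ℝ≥0∞} {J : Type*}

/-- A decomposition of a measure space into countably many pieces `A j`, each a copy `θ j` of the
whole space up to a constant factor `c j` of the measure. -/
structure SelfSimilar (μ : Measure Ω) (J : Type*) where
  /-- the maps onto the pieces -/
  θ : J → Ω → Ω
  /-- the pieces -/
  A : J → Set Ω
  /-- the scaling factors -/
  c : J → ℝ≥0∞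
  measurableEmbedding : ∀ j, MeasurableEmbedding (θ j)
  measurableSet : ∀ j, MeasurableSet (A j)
  disjoint : Pairwise (Function.onFun Disjoint A)
  cover : ∀ᵐ x ∂μ, x ∈ ⋃ j, A j
  c_ne_zero : ∀ j, c j ≠ 0
  c_ne_top : ∀ j, c j ≠ ∞
  map_eq : ∀ j, μ.map (θ j) = c j • μ.restrict (A j)

namespace SelfSimilar

variable (D : SelfSimilar μ J)

theorem ae_of_ae {P : Ω → Prop} (h : ∀ᵐ x ∂μ, P x) (j : J) : ∀ᵐ x ∂μ, P (D.θ j x) := by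
  refine (D.measurableEmbedding j).ae_map_iff.1 ?_
  rw [D.map_eq]
  exact Measure.ae_smul_measure (ae_restrict_of_ae h) _

theorem memLp_comp (f : Lp ℝ p μ) (j : J) : MemLp (f ∘ D.θ j) p μ := by
  rw [← (D.measurableEmbedding j).memLp_map_measure_iff, D.map_eq]
  exact ((Lp.memLp f).restrict _).smul_measure (D.c_ne_top j)

variable [Fact (1 ≤ p)]

/-- The restriction to the piece `A j`, transported to the whole space and normalised. -/
noncomputable def piece (j : J) : Lp ℝ p μ →ₗ[ℝ] Lp ℝ p μ where
  toFun f := ((D.c j).toReal ^ (-p.toReal⁻¹)) • (D.memLp_comp f j).toLp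
  map_add' f g := by
    rw [← smul_add, ← MemLp.toLp_add]
    congr 1
    refine MemLp.toLp_congr _ _ ?_
    exact D.ae_of_ae (Lp.coeFn_add f g) j
  map_smul' a f := by
    have h : (D.memLp_comp (a • f) j).toLp = a • (D.memLp_comp f j).toLp := by
      rw [← MemLp.toLp_const_smul]
      exact MemLp.toLp_congr _ _ (D.ae_of_ae (Lp.coeFn_smul a f) j)
    rw [h, smul_comm, RingHom.id_apply]

theorem norm_piece_rpow (hp : p ≠ ∞) (f : Lp ℝ p μ) (j : J) :
    ‖D.piece j f‖ ^ p.toReal = ∫ t in D.A j, |f t| ^ p.toReal ∂μ := by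
  have hp0 : p ≠ 0 := (zero_lt_one.trans_le Fact.out).ne'
  have hr0 : 0 < p.toReal := ENNReal.toReal_pos hp0 hp
  have hc : 0 < (D.c j).toReal := ENNReal.toReal_pos (D.c_ne_zero j) (D.c_ne_top j)
  have h1 : ‖(D.memLp_comp f j).toLp‖ ^ p.toReal =
      (D.c j).toReal * ∫ t in D.A j, |f t| ^ p.toReal ∂μ := by
    rw [Lp_norm_rpow hp0 hp, ← smul_eq_mul, ← integral_smul_measure, ← D.map_eq,
      (D.measurableEmbedding j).integral_map]
    refine integral_congr_ae ?_
    filter_upwards [(D.memLp_comp f j).coeFn_toLp] with t ht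
    rw [ht]
    rfl
  change ‖((D.c j).toReal ^ (-p.toReal⁻¹)) • (D.memLp_comp f j).toLp‖ ^ p.toReal = _
  rw [norm_smul, Real.mul_rpow (norm_nonneg _) (norm_nonneg _), h1,
    Real.norm_of_nonneg (by positivity), ← Real.rpow_mul hc.le, neg_mul, inv_mul_cancel₀ hr0.ne',
    Real.rpow_neg_one, ← mul_assoc, inv_mul_cancel₀ hc.ne', one_mul]

theorem hasSum_norm_piece [Countable J] (hp : p ≠ ∞) (f : Lp ℝ p μ) :
    HasSum (fun j => ‖D.piece j f‖ ^ p.toReal) (‖f‖ ^ p.toReal) := by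
  have hp0 : p ≠ 0 := (zero_lt_one.trans_le Fact.out).ne'
  simp only [D.norm_piece_rpow hp]
  have h := hasSum_integral_iUnion (μ := μ) (f := fun t => |f t| ^ p.toReal) D.measurableSet
    D.disjoint (integrable_abs_rpow hp0 hp f).integrableOn
  rwa [Measure.restrict_eq_self_of_ae_mem D.cover, ← Lp_norm_rpow hp0 hp] at h

/-- All pieces together, as a linear isometry `L_p → ℓ_p(J; L_p)`. -/
noncomputable def toLp [Countable J] (hp : p ≠ ∞) :
    Lp ℝ p μ →ₗᵢ[ℝ] lp (fun _ : J => Lp ℝ p μ) p where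
  toFun f := ⟨fun j => D.piece j f, memℓp_gen (D.hasSum_norm_piece hp f).summable⟩
  map_add' f g := lp.ext (funext fun j => (D.piece j).map_add f g)
  map_smul' a f := lp.ext (funext fun j => (D.piece j).map_smul a f)
  norm_map' f := by
    have hr0 : 0 < p.toReal := ENNReal.toReal_pos (zero_lt_one.trans_le Fact.out).ne' hp
    have h := lp.hasSum_norm (p := p) (E := fun _ : J => Lp ℝ p μ) hr0
      ⟨fun j => D.piece j f, memℓp_gen (D.hasSum_norm_piece hp f).summable⟩
    have h2 := h.unique (D.hasSum_norm_piece hp f)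
    exact (Real.rpow_left_inj (norm_nonneg _) (norm_nonneg _) hr0.ne').1 h2

theorem toLp_apply [Countable J] (hp : p ≠ ∞) (f : Lp ℝ p μ) (j : J) :
    D.toLp hp f j = D.piece j f := rfl

open Classical in
theorem exists_toLp_eq_single [Countable J] (hp : p ≠ ∞) (j : J) (g : Lp ℝ p μ) :
    ∃ f, D.toLp hp f = lp.single p j g := by
  have hp0 : p ≠ 0 := (zero_lt_one.trans_le Fact.out).ne'
  have hc : 0 < (D.c j).toReal := ENNReal.toReal_pos (D.c_ne_zero j) (D.c_ne_top j)
  set b : ℝ := (D.c j).toReal ^ (-p.toReal⁻¹) with hb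
  have hb0 : b ≠ 0 := by positivity
  -- the function `b⁻¹ • g` transported to the piece `A j`
  set F : Ω → ℝ := Function.extend (D.θ j) (b⁻¹ • ⇑g) 0 with hF
  have hinj := (D.measurableEmbedding j).injective
  have hFθ : F ∘ D.θ j = b⁻¹ • ⇑g := by
    funext x
    simp only [hF, Function.comp_apply, hinj.extend_apply]
  have hmem : MemLp ((D.A j).indicator F) p μ := by
    rw [memLp_indicator_iff_restrict (D.measurableSet j)]
    have h1 : MemLp F p (μ.map (D.θ j)) := by
      rw [(D.measurableEmbedding j).memLp_map_measure_iff, hFθ]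
      exact (Lp.memLp g).const_smul _
    rw [D.map_eq] at h1
    have h2 := h1.smul_measure (c := (D.c j)⁻¹) (by simpa using D.c_ne_zero j)
    rwa [smul_smul, ENNReal.inv_mul_cancel (D.c_ne_zero j) (D.c_ne_top j), one_smul] at h2
  have hae : ∀ i, ∀ᵐ x ∂μ, D.θ i x ∈ D.A i := by
    intro i
    refine (D.measurableEmbedding i).ae_map_iff.1 ?_
    rw [D.map_eq]
    exact Measure.ae_smul_measure (ae_restrict_mem (D.measurableSet i)) _
  refine ⟨hmem.toLp, lp.ext (funext fun i => ?_)⟩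
  rw [D.toLp_apply]
  change ((D.c i).toReal ^ (-p.toReal⁻¹)) • (D.memLp_comp hmem.toLp i).toLp = _
  have hcomp : ∀ᵐ x ∂μ, (hmem.toLp : Lp ℝ p μ) (D.θ i x) = (D.A j).indicator F (D.θ i x) :=
    D.ae_of_ae hmem.coeFn_toLp i
  rcases eq_or_ne i j with rfl | hij
  · rw [lp.single_apply_self]
    rw [← hb]
    apply Lp.ext
    filter_upwards [Lp.coeFn_smul b ((D.memLp_comp hmem.toLp i).toLp), hcomp, hae i,
      (D.memLp_comp hmem.toLp i).coeFn_toLp] with x h1 h2 h3 h4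
    rw [h1, Pi.smul_apply, h4, Function.comp_apply, h2, indicator_of_mem h3,
      ← Function.comp_apply (f := F), hFθ, Pi.smul_apply, smul_smul, mul_inv_cancel₀ hb0, one_smul]
  · rw [lp.single_apply_ne _ _ _ hij]
    apply Lp.ext
    filter_upwards [Lp.coeFn_smul ((D.c i).toReal ^ (-p.toReal⁻¹))
      ((D.memLp_comp hmem.toLp i).toLp), hcomp, hae i,
      (D.memLp_comp hmem.toLp i).coeFn_toLp, Lp.coeFn_zero ℝ p μ] with x h1 h2 h3 h4 h5
    have h6 : D.θ i x ∉ D.A j := fun h => Set.disjoint_left.1 (D.disjoint hij) h3 h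
    rw [h1, Pi.smul_apply, h4, Function.comp_apply, h2, indicator_of_notMem h6, h5, smul_zero,
      Pi.zero_apply]

/-- A self-similar measure space has `L_p ≃ ℓ_p(J; L_p)`. The range of the isometry `toLp` is closed
and contains the sequences with one non-zero entry. -/
theorem nonempty_linearIsometryEquiv [Countable J] (D : SelfSimilar μ J) (hp : p ≠ ∞) :
    Nonempty (lp (fun _ : J => Lp ℝ p μ) p ≃ₗᵢ[ℝ] Lp ℝ p μ) := by
  classical
  refine ⟨(LinearIsometryEquiv.ofSurjective (D.toLp hp) fun v => ?_).symm⟩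
  have hclosed : IsClosed (Set.range (D.toLp hp)) := (D.toLp hp).isometry.isClosedEmbedding.isClosed_range
  refine hclosed.mem_of_tendsto (lp.hasSum_single hp v) (Filter.Eventually.of_forall fun s => ?_)
  change _ ∈ (D.toLp hp).toLinearMap.range
  refine Submodule.sum_mem _ fun j _ => ?_
  obtain ⟨f, hf⟩ := D.exists_toLp_eq_single hp j (v j)
  exact ⟨f, hf⟩

end SelfSimilar

/-- The unit interval is the union of the dyadic intervals `(2⁻ᵏ⁻¹, 2⁻ᵏ]`, up to a null set. -/
noncomputable def selfSimilarUnitInterval (e : J ≃ ℕ) :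
    SelfSimilar (volume.restrict (Icc (0 : ℝ) 1)) J where
  θ j t := (1 / 2) ^ (e j + 1) + (1 / 2) ^ (e j + 1) * t
  A j := Ioc ((1 / 2) ^ (e j + 1)) ((1 / 2) ^ e j)
  c j := ENNReal.ofReal |((1 / 2 : ℝ) ^ (e j + 1))⁻¹|
  measurableEmbedding j := by
    have h : (1 / 2 : ℝ) ^ (e j + 1) ≠ 0 := by positivity
    exact (measurableEmbedding_addLeft _).comp (measurableEmbedding_mulLeft₀ h)
  measurableSet j := measurableSet_Ioc
  disjoint := by
    have key : ∀ k l : ℕ, k < l → Disjoint (Ioc ((1 / 2 : ℝ) ^ (k + 1)) ((1 / 2) ^ k))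
        (Ioc ((1 / 2 : ℝ) ^ (l + 1)) ((1 / 2) ^ l)) := by
      intro k l hkl
      have : (1 / 2 : ℝ) ^ l ≤ (1 / 2) ^ (k + 1) :=
        pow_le_pow_of_le_one (by norm_num) (by norm_num) hkl
      rw [Set.disjoint_left]
      intro x hx hx'
      linarith [hx.1, hx'.2]
    intro i j hij
    rcases lt_or_gt_of_ne (e.injective.ne hij) with h | h
    exacts [key _ _ h, (key _ _ h).symm]
  cover := by
    rw [← Measure.restrict_congr_set Ioc_ae_eq_Icc, ae_restrict_iff' measurableSet_Ioc]
    refine ae_of_all _ fun x hx => ?_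
    obtain ⟨n, hn⟩ := exists_nat_pow_near_of_lt_one hx.1 hx.2 (y := (1 / 2 : ℝ)) (by norm_num)
      (by norm_num)
    refine mem_iUnion.2 ⟨e.symm n, ?_⟩
    rw [e.apply_symm_apply]
    exact hn
  c_ne_zero j := by
    simp
  c_ne_top j := ENNReal.ofReal_ne_top
  map_eq j := by
    set δ : ℝ := (1 / 2) ^ (e j + 1) with hδ
    have hδ0 : 0 < δ := by positivity
    have hδ2 : (1 / 2 : ℝ) ^ e j = 2 * δ := by rw [hδ, pow_succ]; ring
    have hδ1 : 2 * δ ≤ 1 := by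
      rw [← hδ2]
      exact pow_le_one₀ (by norm_num) (by norm_num)
    rw [hδ2, Measure.restrict_restrict measurableSet_Ioc, inter_eq_left.2
      (Ioc_subset_Icc_self.trans (Icc_subset_Icc hδ0.le hδ1)),
      ← Measure.restrict_congr_set Ioc_ae_eq_Icc]
    have hmeas : MeasurableEmbedding fun t : ℝ => δ + δ * t :=
      (measurableEmbedding_addLeft δ).comp (measurableEmbedding_mulLeft₀ hδ0.ne')
    have hvol : volume.map (fun t : ℝ => δ + δ * t) = ENNReal.ofReal |δ⁻¹| • volume := by
      have : (fun t : ℝ => δ + δ * t) = (fun t => δ + t) ∘ fun t => δ * t := rfl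
      rw [this, ← Measure.map_map (by fun_prop) (by fun_prop), Real.map_volume_mul_left hδ0.ne',
        Measure.map_smul, map_add_left_eq_self]
    have hpre : (fun t : ℝ => δ + δ * t) ⁻¹' Ioc δ (2 * δ) = Ioc 0 1 := by
      ext t
      simp only [mem_preimage, mem_Ioc]
      constructor
      · rintro ⟨h1, h2⟩
        constructor <;> nlinarith
      · rintro ⟨h1, h2⟩
        constructor <;> nlinarith
    rw [← Measure.restrict_smul, ← hvol, hmeas.restrict_map, hpre]

/-- `L_p([0,1])` is isometric to its own infinite `ℓ_p`-sum. -/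
theorem nonempty_lp_Lp_equiv [Fact (1 ≤ p)] [Countable J] [Infinite J] (hp : p ≠ ∞) :
    Nonempty (lp (fun _ : J => Lp ℝ p (volume.restrict (Icc (0 : ℝ) 1))) p ≃ₗᵢ[ℝ]
      Lp ℝ p (volume.restrict (Icc (0 : ℝ) 1))) := by
  obtain ⟨e⟩ := nonempty_equiv_of_countable (α := J) (β := ℕ)
  exact (selfSimilarUnitInterval e).nonempty_linearIsometryEquiv hp

end Selfsimilar

end Compression

/-! ### Equivariant maps on the wreath product -/

namespace Compression

open MeasureTheory Set WreathZ

/-- The space `L_p([0,1])`. -/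
abbrev UnitLp (p : ℝ≥0∞) : Type := Lp ℝ p (volume.restrict (Icc (0 : ℝ) 1))

theorem countable_of_closure {G : Type*} [Group G] {S : Set G} (hSfin : S.Finite)
    (hS : Subgroup.closure S = ⊤) : Countable G := by
  have : Countable ↥(S ∪ S⁻¹) := (hSfin.union hSfin.inv).countable
  refine Function.Surjective.countable (f := fun l : List ↥(S ∪ S⁻¹) => (l.map Subtype.val).prod)
    fun g => ?_
  obtain ⟨l, hl, hl', rfl⟩ := exists_word hS g
  lift l to List ↥(S ∪ S⁻¹) using hl'
  exact ⟨l, rfl⟩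

variable {p : ℝ≥0∞} [Fact (1 ≤ p)]

theorem exists_norm_eq_one (hp : p ≠ ∞) : ∃ e : UnitLp p, ‖e‖ = 1 := by
  refine ⟨Lp.const p _ (1 : ℝ), ?_⟩
  have hp0 : p ≠ 0 := (zero_lt_one.trans_le Fact.out).ne'
  rw [Lp.norm_const' _ _ _ hp0 hp]
  simp

/-- Finitely many equivariant maps are dominated by one. -/
theorem exists_isEquivariant_ge {G : Type*} [Group G] (hp : p ≠ ∞) {n : ℕ}
    (Ψ : Fin n → G → UnitLp p) (hΨ : ∀ k, IsEquivariant (Ψ k)) :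
    ∃ Θ : G → UnitLp p, IsEquivariant Θ ∧ ∀ k g, ‖Ψ k g - Ψ k 1‖ ≤ ‖Θ g - Θ 1‖ := by
  have hr0 : 0 < p.toReal := ENNReal.toReal_pos (zero_lt_one.trans_le Fact.out).ne' hp
  choose τ v hv using hΨ
  obtain ⟨Φ⟩ := nonempty_lp_Lp_equiv (J := ℕ) hp
  let τ' : ℕ → G →* (UnitLp p ≃ᵃⁱ[ℝ] UnitLp p) := fun k => if h : k < n then τ ⟨k, h⟩ else 1
  let ξ₀ : ℕ → UnitLp p := fun k => if h : k < n then v ⟨k, h⟩ else 0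
  have hlt : ∀ (k : Fin n) g, τ' k g (ξ₀ k) = Ψ k g := fun k g => by
    simp [τ', ξ₀, hv]
  obtain ⟨Θ, hΘ, hsum⟩ := exists_isEquivariant_of_action hp Φ (fun g ξ k => τ' k g (ξ k))
    (fun ξ => by funext k; simp) (fun g h ξ => by funext k; simp)
    (fun g => ⟨1, fun ξ η k => by
      rw [← dist_eq_norm, AffineIsometryEquiv.dist_map, dist_eq_norm]
      rfl⟩) ξ₀ (fun g => by
      refine memℓp_gen (summable_of_hasFiniteSupport ((Set.finite_lt_nat n).subset fun k hk => ?_))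
      by_contra h
      have h' : ¬ k < n := h
      refine hk ?_
      simp [τ', ξ₀, h', Real.zero_rpow hr0.ne'])
  refine ⟨Θ, hΘ, fun k g => ?_⟩
  have h1 := le_hasSum (hsum g) k fun j _ => by positivity
  have h2 : ξ₀ k = Ψ k 1 := by
    rw [← hlt k 1, map_one]
    rfl
  simp only [hlt] at h1
  rw [h2] at h1
  exact (Real.rpow_le_rpow_iff (norm_nonneg _) (norm_nonneg _) hr0).1 h1

variable {H : Type*} [Group H]

/-- The cursor position: `ℤ` acts by translations. -/
theorem exists_isEquivariant_pos (hp : p ≠ ∞) : ∃ Ψ : WreathZ H → UnitLp p, IsEquivariant Ψ ∧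
    ∀ g, ‖Ψ g - Ψ 1‖ = |(g.pos : ℝ)| := by
  obtain ⟨e, he⟩ := exists_norm_eq_one (p := p) hp
  let τ : WreathZ H →* (UnitLp p ≃ᵃⁱ[ℝ] UnitLp p) :=
    { toFun := fun g => AffineIsometryEquiv.constVAdd ℝ (UnitLp p) ((g.pos : ℝ) • e)
      map_one' := by
        ext1 v
        simp
      map_mul' := fun g h => by
        ext1 v
        simp [add_smul, add_assoc] }
  refine ⟨fun g => τ g 0, ⟨τ, 0, fun _ => rfl⟩, fun g => ?_⟩
  simp [τ, norm_smul, he]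

/-- The lamps: `H ≀ ℤ` acts on `⊕_ℤ L_p` through an action of `H` on each summand. -/
theorem exists_isEquivariant_lamps (hp : p ≠ ∞) {Ψ : H → UnitLp p} (hΨ : IsEquivariant Ψ) :
    ∃ Θ : WreathZ H → UnitLp p, IsEquivariant Θ ∧
      ∀ g, HasSum (fun x => ‖Ψ (g.lamp x) - Ψ 1‖ ^ p.toReal) (‖Θ g - Θ 1‖ ^ p.toReal) := by
  have hr0 : 0 < p.toReal := ENNReal.toReal_pos (zero_lt_one.trans_le Fact.out).ne' hp
  obtain ⟨τ, v, hv⟩ := hΨ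
  obtain ⟨Φ⟩ := nonempty_lp_Lp_equiv (J := ℤ) hp
  have h1 : Ψ 1 = v := by
    rw [hv, map_one]
    rfl
  obtain ⟨Θ, hΘ, hsum⟩ := exists_isEquivariant_of_action hp Φ
    (fun (g : WreathZ H) ξ x => τ (g.lamp x) (ξ (x - g.pos)))
    (fun ξ => by funext x; simp) (fun g h ξ => by funext x; simp [sub_sub])
    (fun g => ⟨Equiv.subRight g.pos, fun ξ η x => by
      rw [← dist_eq_norm, AffineIsometryEquiv.dist_map, dist_eq_norm]
      rfl⟩) (fun _ => v) (fun g => by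
      refine memℓp_gen (summable_of_hasFiniteSupport (g.finite_support.subset fun x hx => ?_))
      rw [Function.mem_mulSupport]
      intro h
      refine hx ?_
      simp [h, Real.zero_rpow hr0.ne'])
  refine ⟨Θ, hΘ, fun g => ?_⟩
  rw [h1]
  simpa only [hv] using hsum g

/-- The configurations with cursor `0` all of whose lamps on `(0, ∞)` are off. The cosets of this
subgroup are the pairs consisting of a position `x` and the state of the lamps on `(x, ∞)`. -/
def leftLamps (H : Type*) [Group H] : Subgroup (WreathZ H) where
  carrier := {g | g.pos = 0 ∧ ∀ y, 0 < y → g.lamp y = 1}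
  mul_mem' := fun {a b} ha hb => ⟨by simp [ha.1, hb.1], fun y hy => by
    simp [ha.1, ha.2 y hy, hb.2 y hy]⟩
  one_mem' := ⟨rfl, fun _ _ => rfl⟩
  inv_mem' := fun {a} ha => ⟨by simp [ha.1], fun y hy => by simp [ha.1, ha.2 y hy]⟩

theorem mem_leftLamps {g : WreathZ H} :
    g ∈ leftLamps H ↔ g.pos = 0 ∧ ∀ y, 0 < y → g.lamp y = 1 := Iff.rfl

/-- The coset of the position `x` with all lamps on `(x, ∞)` off. -/
def ray (H : Type*) [Group H] (x : ℤ) : WreathZ H ⧸ leftLamps H := ((shift x : WreathZ H) : _ ⧸ _)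

theorem ray_injective : Function.Injective (ray H) := by
  intro x y h
  have := (QuotientGroup.eq.1 h).1
  simp only [pos_mul, pos_inv, shift_pos] at this
  omega

theorem natRay_injective : Function.Injective fun x : ℕ => ray H x := fun x y h => by
  exact_mod_cast ray_injective h

theorem shift_smul_ray (i x : ℤ) : (shift i : WreathZ H) • ray H x = ray H (i + x) := by
  rw [ray, ray, shift_add]
  rfl

theorem lampHom_smul_ray (h : H) {x : ℤ} (hx : 0 ≤ x) : lampHom h • ray H x = ray H x := by
  refine (QuotientGroup.eq.2 ?_).symm
  refine mem_leftLamps.2 ⟨by simp, fun y hy => ?_⟩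
  have : y + x ≠ 0 := by omega
  simp [this]

/-- If `g⁻¹` maps the point `x` of the ray into the ray, then all lamps of `g` beyond `x` are off. -/
theorem lamp_eq_one_of_smul_ray_eq {g : WreathZ H} {x x' : ℤ} (h : g⁻¹ • ray H x = ray H x')
    {z : ℤ} (hz : x < z) : g.lamp z = 1 := by
  have h1 : ray H x = g • ray H x' := by rw [← h, smul_inv_smul]
  have h2 := (QuotientGroup.eq.1 (show ((shift x : WreathZ H) : WreathZ H ⧸ leftLamps H) =
    ((g * shift x' : WreathZ H) : WreathZ H ⧸ leftLamps H) from h1)).2 (z - x) (by omega)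
  simpa using h2

/-- The farthest lit lamp on the right. For weights `w` with `p`-summable increments, there is an
equivariant map whose displacement is at least the `ℓ_p` norm of `w` on `{0, …, R - 1}` as soon as a
lamp beyond `R` is lit. -/
theorem exists_isEquivariant_range [Countable (WreathZ H)] (hp : p ≠ ∞) {w : ℕ → ℝ}
    (hw : Summable fun x => |w (x + 1) - w x| ^ p.toReal) :
    ∃ Θ : WreathZ H → UnitLp p, IsEquivariant Θ ∧
      ∀ (g : WreathZ H) (R : ℕ) (z : ℤ), R ≤ z → g.lamp z ≠ 1 →
        ∑ x ∈ Finset.range R, |w x| ^ p.toReal ≤ ‖Θ g - Θ 1‖ ^ p.toReal := by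
  have hr0 : 0 < p.toReal := ENNReal.toReal_pos (zero_lt_one.trans_le Fact.out).ne' hp
  obtain ⟨e, he⟩ := exists_norm_eq_one (p := p) hp
  let J := WreathZ H ⧸ leftLamps H
  have : Countable J := Quotient.countable
  have : Infinite J := Infinite.of_injective _ (natRay_injective (H := H))
  obtain ⟨Φ⟩ := nonempty_lp_Lp_equiv (J := J) hp
  let ξ₀ : J → UnitLp p := Function.extend (fun x : ℕ => ray H x) (fun x => w x • e) 0
  have hray : ∀ x : ℕ, ξ₀ (ray H x) = w x • e := fun x =>
    natRay_injective.extend_apply (fun x : ℕ => w x • e) 0 x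
  have hnot : ∀ y : J, (¬ ∃ x : ℕ, ray H x = y) → ξ₀ y = 0 := fun y hy =>
    Function.extend_apply' _ _ y hy
  let act : WreathZ H → (J → UnitLp p) → J → UnitLp p := fun g ξ y => ξ (g⁻¹ • y)
  have h1 : ∀ ξ, act 1 ξ = ξ := fun ξ => by funext y; simp [act]
  have hmul : ∀ g h ξ, act (g * h) ξ = act g (act h ξ) := fun g h ξ => by
    funext y
    simp [act, mul_smul]
  have hiso : ∀ g, ∃ σ : Equiv.Perm J, ∀ ξ η j,
      ‖act g ξ j - act g η j‖ = ‖ξ (σ j) - η (σ j)‖ := fun g =>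
    ⟨MulAction.toPerm g⁻¹, fun ξ η j => rfl⟩
  have hmem : ∀ g, Memℓp (act g ξ₀ - ξ₀) p := by
    intro g
    have hg : g ∈ Subgroup.closure (lampHom '' Set.univ ∪ {shift 1} : Set (WreathZ H)) := by
      rw [closure_eq_top Subgroup.closure_univ]
      trivial
    induction hg using Subgroup.closure_induction with
    | mem g hg =>
      rcases hg with ⟨h, -, rfl⟩ | hg
      · have : act (lampHom h) ξ₀ = ξ₀ := by
          funext y
          change ξ₀ ((lampHom h)⁻¹ • y) = ξ₀ y
          rw [← map_inv]
          by_cases hy : ∃ x : ℕ, ray H x = y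
          · obtain ⟨x, rfl⟩ := hy
            rw [lampHom_smul_ray _ (by positivity)]
          · rw [hnot y hy, hnot]
            rintro ⟨x, hx⟩
            refine hy ⟨x, ?_⟩
            rw [map_inv, eq_inv_smul_iff, lampHom_smul_ray _ (by positivity)] at hx
            exact hx
        rw [this, sub_self]
        exact zero_memℓp
      · rw [Set.mem_singleton_iff.1 hg]
        have hshift : ∀ y : J, act (shift 1) ξ₀ y = ξ₀ ((shift (-1) : WreathZ H) • y) := by
          intro y
          change ξ₀ ((shift 1)⁻¹ • y) = _
          rw [shift_inv]
        refine memℓp_gen ((natRay_injective (H := H)).summable_iff ?_ |>.1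
          ((summable_nat_add_iff 1).1 (hw.congr fun x => ?_)))
        · intro y hy
          have hy' : ¬ ∃ x : ℕ, ray H x = y := hy
          have hy2 : ¬ ∃ x : ℕ, ray H x = (shift (-1) : WreathZ H) • y := by
            rintro ⟨x, hx⟩
            refine hy' ⟨x + 1, ?_⟩
            rw [← shift_inv, eq_inv_smul_iff, shift_smul_ray] at hx
            rw [← hx]
            congr 1
            push_cast
            ring
          rw [Pi.sub_apply, hshift, hnot _ hy', hnot _ hy2, sub_zero, norm_zero,
            Real.zero_rpow hr0.ne']
        · have e1 : (-1 : ℤ) + ((x + 1 : ℕ) : ℤ) = (x : ℕ) := by push_cast; ring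
          simp only [Function.comp_apply]
          rw [Pi.sub_apply, hshift, shift_smul_ray, e1, hray, hray, ← sub_smul, norm_smul, he,
            mul_one, Real.norm_eq_abs, abs_sub_comm]
    | one => rw [h1, sub_self]; exact zero_memℓp
    | mul g h _ _ hg hh =>
      obtain ⟨σ, hσ⟩ := hiso g
      rw [hmul, ← sub_add_sub_cancel _ (act g ξ₀)]
      exact (memℓp_sub_of_reindex hp σ (hσ _ _) hh).add hg
    | inv g _ hg =>
      obtain ⟨σ, hσ⟩ := hiso g⁻¹
      have h2 := memℓp_sub_of_reindex hp σ (hσ _ _) hg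
      rw [← hmul, inv_mul_cancel, h1] at h2
      rw [← neg_sub]
      exact h2.neg
  obtain ⟨Θ, hΘ, hsum⟩ := exists_isEquivariant_of_action hp Φ act h1 hmul hiso ξ₀ hmem
  refine ⟨Θ, hΘ, fun g R z hRz hz => ?_⟩
  have hle := sum_le_hasSum ((Finset.range R).map ⟨fun x : ℕ => ray H x, natRay_injective⟩)
    (fun j _ => by positivity) (hsum g)
  rw [Finset.sum_map] at hle
  refine le_trans (Finset.sum_le_sum fun x hx => le_of_eq ?_) hle
  have hx' : (x : ℤ) < z := by
    have := Finset.mem_range.1 hx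
    omega
  have h2 : act g ξ₀ (ray H x) = 0 := by
    refine hnot _ ?_
    rintro ⟨x', hx2⟩
    exact hz (lamp_eq_one_of_smul_ray_eq hx2.symm hx')
  simp only [Function.Embedding.coeFn_mk]
  rw [h2, hray, zero_sub, norm_neg, norm_smul, he, mul_one, Real.norm_eq_abs]

end Compression

/-! ### The lower bound -/

namespace Compression

open MeasureTheory Set WreathZ

theorem abs_add_one_rpow_sub_rpow_le {y θ : ℝ} (hy : 0 < y) (hθ : |θ| ≤ 1) :
    |(y + 1) ^ θ - y ^ θ| ≤ y ^ (θ - 1) := by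
  set t : ℝ := (y + 1) / y with ht
  have hyt : y + 1 = y * t := by rw [ht]; field_simp
  have ht1 : 1 ≤ t := by
    rw [ht, le_div_iff₀ hy]
    linarith
  have ht0 : 0 < t := by linarith
  have hty : t - 1 = y⁻¹ := by
    rw [ht]
    field_simp
    simp
  rw [hyt, Real.mul_rpow hy.le ht0.le, ← mul_sub_one, abs_mul, abs_of_nonneg (by positivity),
    Real.rpow_sub_one hy.ne', div_eq_mul_inv, ← hty]
  refine mul_le_mul_of_nonneg_left ?_ (by positivity)
  obtain ⟨h1, h2⟩ := abs_le.1 hθ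
  rw [abs_le]
  constructor
  · have h3 : t ^ (-1 : ℝ) ≤ t ^ θ := Real.rpow_le_rpow_of_exponent_le ht1 h1
    rw [Real.rpow_neg_one] at h3
    have h4 : 1 - t⁻¹ ≤ t - 1 := by
      rw [← sub_nonneg, show t - 1 - (1 - t⁻¹) = (t - 1) ^ 2 / t by field_simp]
      positivity
    linarith
  · have h3 : t ^ θ ≤ t ^ (1 : ℝ) := Real.rpow_le_rpow_of_exponent_le ht1 h2
    rw [Real.rpow_one] at h3
    linarith

/-- `∑_{x < R} (x + 1) ^ (q - 1) ≥ R ^ q / 2` for `0 < q ≤ 2`. -/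
theorem rpow_le_two_mul_sum {q : ℝ} (hq0 : 0 < q) (hq2 : q ≤ 2) (R : ℕ) :
    (R : ℝ) ^ q ≤ 2 * ∑ x ∈ Finset.range R, ((x : ℝ) + 1) ^ (q - 1) := by
  induction R with
  | zero => simp [Real.zero_rpow hq0.ne']
  | succ R ih =>
    rw [Finset.sum_range_succ, mul_add]
    push_cast
    have hR : (0 : ℝ) ≤ R := by positivity
    set y : ℝ := R + 1 with hy
    have hy0 : 0 < y := by positivity
    have hRy : (R : ℝ) = y * (R / y) := by field_simp
    have hb0 : 0 ≤ R / y := by positivity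
    have hb1 : R / y ≤ 1 := by rw [div_le_one hy0]; linarith
    have h1 : (R / y) ^ (2 : ℕ) ≤ (R / y) ^ q := by
      rcases hb0.eq_or_lt with h | h
      · rw [← h, Real.zero_rpow hq0.ne']
        norm_num
      · rw [← Real.rpow_natCast]
        exact Real.rpow_le_rpow_of_exponent_ge h hb1 (by simpa using hq2)
    have h2 : 1 - 2 / y ≤ (R / y) ^ (2 : ℕ) := by
      have : (R : ℝ) / y = 1 - 1 / y := by
        field_simp
        rw [hy]
        ring
      rw [this]
      have : (1 - 1 / y) ^ 2 = 1 - 2 / y + (1 / y) ^ 2 := by ring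
      nlinarith [sq_nonneg (1 / y)]
    have h3 : y ^ q * (1 - 2 / y) ≤ (R : ℝ) ^ q := by
      rw [hRy, Real.mul_rpow hy0.le hb0]
      gcongr
      exact h2.trans h1
    have h4 : y ^ q * (1 - 2 / y) = y ^ q - 2 * y ^ (q - 1) := by
      rw [Real.rpow_sub_one hy0.ne']
      field_simp
    linarith

variable {p : ℝ≥0∞} [Fact (1 ≤ p)] {H : Type*} [Group H]

/-- For every `s < 1` there is an equivariant map with displacement at least `ρ ^ s / 2` whenever a
lamp at a position `≥ ρ` is lit. The weights are `(x + 1) ^ (s - 1 / p)`. -/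
theorem exists_isEquivariant_rpow_range [Countable (WreathZ H)] (hp2 : p ≤ 2) {s : ℝ} (hs0 : 0 < s)
    (hs1 : s < 1) : ∃ Θ : WreathZ H → UnitLp p, IsEquivariant Θ ∧
      ∀ (g : WreathZ H) (R : ℕ) (z : ℤ), R ≤ z → g.lamp z ≠ 1 →
        (R : ℝ) ^ s ≤ 2 * ‖Θ g - Θ 1‖ := by
  have hp : p ≠ ∞ := ne_top_of_le_ne_top (by simp) hp2
  set r := p.toReal with hr
  have hr1 : 1 ≤ r := by simpa using ENNReal.toReal_mono hp (Fact.out : 1 ≤ p)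
  have hr2 : r ≤ 2 := by simpa using ENNReal.toReal_mono (by simp) hp2
  have hr0 : 0 < r := by linarith
  have hinv0 : 0 < r⁻¹ := by positivity
  have hinv1 : r⁻¹ ≤ 1 := inv_le_one_of_one_le₀ hr1
  set θ : ℝ := s - r⁻¹ with hθ
  have hθ1 : |θ| ≤ 1 := by rw [abs_le]; constructor <;> linarith
  set w : ℕ → ℝ := fun x => ((x : ℝ) + 1) ^ θ with hw
  have hsum : Summable fun x => |w (x + 1) - w x| ^ r := by
    have h1 : Summable fun x : ℕ => ((x : ℝ) + 1) ^ ((θ - 1) * r) := by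
      have h2 : (θ - 1) * r < -1 := by
        have : (θ - 1) * r = (s - 1) * r - 1 := by
          rw [hθ]
          field_simp
          ring
        nlinarith
      have h3 := (summable_nat_add_iff 1).2 (Real.summable_nat_rpow.2 h2)
      simpa using h3
    refine Summable.of_nonneg_of_le (fun x => by positivity) (fun x => ?_) h1
    have h4 := abs_add_one_rpow_sub_rpow_le (y := (x : ℝ) + 1) (by positivity) hθ1
    rw [Real.rpow_mul (by positivity)]
    refine Real.rpow_le_rpow (abs_nonneg _) ?_ hr0.le
    simpa [hw] using h4
  obtain ⟨Θ, hΘ, h⟩ := exists_isEquivariant_range (H := H) hp hsum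
  refine ⟨Θ, hΘ, fun g R z hR hz => ?_⟩
  have h1 := h g R z hR hz
  have h2 := rpow_le_two_mul_sum (q := s * r) (by positivity) (by nlinarith) R
  have h3 : ∀ x : ℕ, |w x| ^ r = ((x : ℝ) + 1) ^ (s * r - 1) := by
    intro x
    rw [hw, abs_of_nonneg (by positivity), ← Real.rpow_mul (by positivity), hθ, sub_mul,
      inv_mul_cancel₀ hr0.ne']
  simp only [← hr, h3] at h1
  have h4 : ((R : ℝ) ^ s) ^ r ≤ (2 * ‖Θ g - Θ 1‖) ^ r := by
    rw [← Real.rpow_mul (by positivity), Real.mul_rpow (by norm_num) (norm_nonneg _)]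
    have h5 : (2 : ℝ) ≤ 2 ^ r := by
      simpa using Real.rpow_le_rpow_of_exponent_le (x := 2) (by norm_num) hr1
    have h6 : 0 ≤ ‖Θ g - Θ 1‖ ^ r := by positivity
    nlinarith
  exact (Real.rpow_le_rpow_iff (by positivity) (by positivity) hr0).1 h4

/-- `(∑ a) ^ q ≤ n ^ k ∑ a ^ q` with `k = max (q - 1) 0`, for a sum of `n` terms. -/
theorem sum_rpow_le_card_rpow_mul {ι : Type*} (t : Finset ι) {a : ι → ℝ} (ha : ∀ i, 0 ≤ a i)
    {q : ℝ} (hq : 0 < q) :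
    (∑ i ∈ t, a i) ^ q ≤ (t.card : ℝ) ^ (max (q - 1) 0) * ∑ i ∈ t, a i ^ q := by
  rcases le_total 1 q with h | h
  · rw [max_eq_left (by linarith)]
    exact Real.rpow_sum_le_const_mul_sum_rpow_of_nonneg t h fun i _ => ha i
  · rw [max_eq_right (by linarith), Real.rpow_zero, one_mul]
    have hadd : ∀ x y : ℝ, 0 ≤ x → 0 ≤ y → (x + y) ^ q ≤ x ^ q + y ^ q := by
      intro x y hx hy
      lift x to ℝ≥0 using hx
      lift y to ℝ≥0 using hy
      exact_mod_cast NNReal.rpow_add_le_add_rpow x y hq.le h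
    classical
    induction t using Finset.induction_on with
    | empty => simp [Real.zero_rpow hq.ne']
    | insert i t hi ih =>
      rw [Finset.sum_insert hi, Finset.sum_insert hi]
      exact (hadd _ _ (ha i) (Finset.sum_nonneg fun j _ => ha j)).trans (by gcongr)

/-- The slack in `β < α / (α + 1 - 1 / r)` leaves room for a range exponent `s < 1`. -/
theorem exists_range_exponent {α β r : ℝ} (hr : 1 ≤ r) (hβ0 : 0 < β) (hβα : β ≤ α)
    (hlt : β * (α + (1 - r⁻¹)) < α) : ∃ s : ℝ, β ≤ s ∧ s < 1 ∧
      β * max (α * r - 1) 0 ≤ s * (α * r - β * r) := by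
  have hr0 : 0 < r := by linarith
  have hinv1 : r⁻¹ ≤ 1 := inv_le_one_of_one_le₀ hr
  have hα : 0 < α := by linarith
  have hβ1 : β < 1 := by
    by_contra! h
    nlinarith [mul_nonneg hβ0.le (sub_nonneg.2 hinv1)]
  have hq : 0 ≤ α * r - β * r := by nlinarith
  rcases le_total (α * r) 1 with h | h
  · refine ⟨β, le_rfl, hβ1, ?_⟩
    rw [max_eq_right (by linarith), mul_zero]
    positivity
  · rw [max_eq_left (by linarith)]
    have h1 : β * (α * r - 1) < α * r - β * r := by
      have : β * (α + (1 - r⁻¹)) * r = β * (α * r - 1) + β * r := by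
        field_simp
        ring
      nlinarith
    have h2 : 0 ≤ β * (α * r - 1) := by
      have : 0 ≤ α * r - 1 := by linarith
      positivity
    have h3 : 0 < α * r - β * r := by linarith
    refine ⟨max β (β * (α * r - 1) / (α * r - β * r)), le_max_left _ _,
      max_lt hβ1 ((div_lt_one h3).2 h1), ?_⟩
    rw [← div_le_iff₀ h3]
    exact le_max_right _ _

/-- Hölder's inequality with the range bound: `∑ a ≤ 4 D ^ (1 / β)` if there are at most
`4 D ^ (1 / s)` terms and `∑ a ^ q ≤ D ^ r`. -/
theorem sum_le_of_sum_rpow_le {ι : Type*} {q r s β D : ℝ} (hq0 : 0 < q) (hβ0 : 0 < β) (hs0 : 0 < s)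
    (hD1 : 1 ≤ D) (F : Finset ι) {a : ι → ℝ} (ha : ∀ i, 0 ≤ a i)
    (hcard : (F.card : ℝ) ≤ 4 * D ^ (1 / s)) (hsum : ∑ i ∈ F, a i ^ q ≤ D ^ r)
    (hs : β * max (q - 1) 0 ≤ s * (q - β * r)) : ∑ i ∈ F, a i ≤ 4 * D ^ (1 / β) := by
  have hD0 : 0 ≤ D := by linarith
  set k := max (q - 1) 0 with hk
  have hk0 : 0 ≤ k := le_max_right _ _
  have hkq : k ≤ q := max_le (by linarith) hq0.le
  set L := ∑ i ∈ F, a i with hL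
  have hL0 : 0 ≤ L := Finset.sum_nonneg fun x _ => ha x
  have hLq : L ^ q ≤ 4 ^ k * D ^ (k / s + r) := by
    calc L ^ q ≤ (F.card : ℝ) ^ k * ∑ i ∈ F, a i ^ q := sum_rpow_le_card_rpow_mul F ha hq0
      _ ≤ (4 * D ^ (1 / s)) ^ k * D ^ r := by
          have h0 : 0 ≤ ∑ i ∈ F, a i ^ q := Finset.sum_nonneg fun i _ => Real.rpow_nonneg (ha i) _
          gcongr
      _ = 4 ^ k * D ^ (k / s + r) := by
          rw [Real.mul_rpow (by norm_num) (by positivity), ← Real.rpow_mul hD0, mul_assoc,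
            ← Real.rpow_add (by linarith), one_div_mul_eq_div]
  have h1 : L ≤ (4 ^ k * D ^ (k / s + r)) ^ (1 / q) := by
    have := Real.rpow_le_rpow (by positivity) hLq (by positivity : 0 ≤ 1 / q)
    rwa [← Real.rpow_mul hL0, mul_one_div_cancel hq0.ne', Real.rpow_one] at this
  rw [Real.mul_rpow (by positivity) (by positivity), ← Real.rpow_mul (by norm_num),
    ← Real.rpow_mul hD0] at h1
  have h2 : (4 : ℝ) ^ (k * (1 / q)) ≤ 4 := by
    have : k * (1 / q) ≤ 1 := by
      rw [mul_one_div, div_le_one hq0]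
      exact hkq
    simpa using Real.rpow_le_rpow_of_exponent_le (x := 4) (by norm_num) this
  have h3 : D ^ ((k / s + r) * (1 / q)) ≤ D ^ (1 / β) := by
    refine Real.rpow_le_rpow_of_exponent_le hD1 ?_
    rw [mul_one_div, div_le_div_iff₀ hq0 hβ0, one_mul]
    have h4 : β * k / s ≤ q - β * r := by
      rw [div_le_iff₀ hs0]
      linarith
    calc (k / s + r) * β = β * k / s + β * r := by ring
      _ ≤ q := by linarith
  exact h1.trans (mul_le_mul h2 h3 (by positivity) (by norm_num))

variable {S : Set H} {T : Set (WreathZ H)}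

/-- The lower bound: the cursor, the lamps, and the range on either side together detect the word
length. With `D` the displacement, the range is at most `D ^ (1 / s)` and `∑ |f x| ^ (α r) ≤ D ^ r`, so
that Hölder's inequality bounds `∑ |f x|`. -/
theorem Admissible.wreath (hp2 : p ≤ 2) (hSfin : S.Finite) (hS : Subgroup.closure S = ⊤)
    (hTfin : T.Finite) (hT : Subgroup.closure T = ⊤) {α β : ℝ} (hβ0 : 0 < β) (hβα : β ≤ α)
    (hlt : β * (α + (1 - p.toReal⁻¹)) < α) (h : Admissible S (UnitLp p) α) :
    Admissible T (UnitLp p) β := by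
  have hp : p ≠ ∞ := ne_top_of_le_ne_top (by simp) hp2
  have hcount : Countable (WreathZ H) := countable_of_closure hTfin hT
  set r := p.toReal with hr
  have hr1 : 1 ≤ r := by simpa using ENNReal.toReal_mono hp (Fact.out : 1 ≤ p)
  have hr0 : 0 < r := by linarith
  have hα : 0 < α := by linarith
  obtain ⟨s, hβs, hs1, hs⟩ := exists_range_exponent hr1 hβ0 hβα hlt
  have hs0 : 0 < s := by linarith
  obtain ⟨Ψ, hΨ, c, hc, hlow⟩ := h
  obtain ⟨Θ₁, hΘ₁, h₁⟩ := exists_isEquivariant_pos (p := p) (H := H) hp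
  obtain ⟨Θ₂, hΘ₂, h₂⟩ := exists_isEquivariant_lamps hp hΨ
  obtain ⟨Θ₃, hΘ₃, h₃⟩ := exists_isEquivariant_rpow_range (p := p) (H := H) hp2 hs0 hs1
  obtain ⟨Θ, hΘ, hge⟩ := exists_isEquivariant_ge hp ![Θ₁, Θ₂, Θ₃, fun g => Θ₃ (reflect g)] (by
    intro k
    fin_cases k
    exacts [hΘ₁, hΘ₂, hΘ₃, hΘ₃.comp_hom reflect])
  obtain ⟨M, hM0, hM⟩ := exists_wordLength_le hSfin hS hT
  set C : ℝ := 2 + c⁻¹ with hC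
  have hcinv : 0 < c⁻¹ := by positivity
  have hC0 : 0 < C := by positivity
  refine ⟨Θ, hΘ, ((13 * M) ^ β * C)⁻¹, by positivity, fun g hg => ?_⟩
  set N := ‖Θ g - Θ 1‖ with hN
  have hN0 : 0 ≤ N := norm_nonneg _
  set D := C * N with hD
  have hD0 : 0 ≤ D := by positivity
  have hge₁ : ‖Θ₁ g - Θ₁ 1‖ ≤ N := hge 0 g
  have hge₂ : ‖Θ₂ g - Θ₂ 1‖ ≤ N := hge 1 g
  have hge₃ : ‖Θ₃ g - Θ₃ 1‖ ≤ N := hge 2 g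
  have hge₄ : ‖Θ₃ (reflect g) - Θ₃ 1‖ ≤ N := by
    have : ‖Θ₃ (reflect g) - Θ₃ (reflect 1)‖ ≤ N := hge 3 g
    rwa [map_one] at this
  have h2ND : 2 * N ≤ D := by rw [hD]; gcongr; linarith
  have hpos : |(g.pos : ℝ)| ≤ D := by
    rw [← h₁]
    linarith
  have hrange : ∀ z : ℤ, g.lamp z ≠ 1 → (z.natAbs : ℝ) ^ s ≤ D := by
    intro z hz
    refine le_trans ?_ h2ND
    rcases le_total 0 z with h0 | h0
    · exact (h₃ g z.natAbs z (by omega) hz).trans (by linarith)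
    · exact (h₃ (reflect g) z.natAbs (-z) (by omega) (by simpa using hz)).trans (by linarith)
  have hlamp : ∀ t : Finset ℤ, ∑ x ∈ t, (wordLength S (g.lamp x) : ℝ) ^ (α * r) ≤ D ^ r := by
    intro t
    have h1 := (sum_le_hasSum t (fun x _ => by positivity) (h₂ g)).trans
      (Real.rpow_le_rpow (norm_nonneg _) hge₂ hr0.le)
    have h2 : ∀ x, c ^ r * (wordLength S (g.lamp x) : ℝ) ^ (α * r) ≤
        ‖Ψ (g.lamp x) - Ψ 1‖ ^ r := by
      intro x
      rw [Real.rpow_mul (by positivity), ← Real.mul_rpow hc.le (by positivity)]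
      refine Real.rpow_le_rpow (by positivity) ?_ hr0.le
      by_cases hx : g.lamp x = 1
      · simp [hx, wordLength_one, Real.zero_rpow hα.ne']
      · exact hlow _ hx
    have h3 := (Finset.sum_le_sum fun x (_ : x ∈ t) => h2 x).trans h1
    rw [← Finset.mul_sum] at h3
    have h4 : c⁻¹ * N ≤ D := by rw [hD]; gcongr; linarith
    have h5 : (c⁻¹ * N) ^ r ≤ D ^ r := Real.rpow_le_rpow (by positivity) h4 hr0.le
    refine le_trans ?_ h5
    rw [Real.mul_rpow hcinv.le hN0, Real.inv_rpow hc.le, ← div_eq_inv_mul,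
      le_div_iff₀ (by positivity), mul_comm]
    exact h3
  have hD1 : 1 ≤ D := by
    by_cases hlit : ∃ x, g.lamp x ≠ 1
    · obtain ⟨x, hx⟩ := hlit
      have h1 := hlamp {x}
      rw [Finset.sum_singleton] at h1
      have h2 : (1 : ℝ) ≤ (wordLength S (g.lamp x) : ℝ) ^ (α * r) :=
        Real.one_le_rpow (by exact_mod_cast one_le_wordLength hS hx) (by positivity)
      by_contra! h3
      linarith [Real.rpow_lt_one hD0 h3 hr0]
    · push Not at hlit
      refine le_trans ?_ hpos
      have : g.pos ≠ 0 := by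
        intro h0
        exact hg (WreathZ.ext (funext hlit) h0)
      exact_mod_cast Int.one_le_abs this
  have hDpow : ∀ {e : ℝ}, e ≤ 1 / β → D ^ e ≤ D ^ (1 / β) := fun he =>
    Real.rpow_le_rpow_of_exponent_le hD1 he
  have hD1β : D ≤ D ^ (1 / β) := by
    have h1 : (1 : ℝ) ≤ 1 / β := by
      rw [le_div_iff₀ hβ0]
      linarith
    simpa using hDpow h1
  have hDs : D ^ (1 / s) ≤ D ^ (1 / β) := hDpow (one_div_le_one_div_of_le hβ0 hβs)
  -- the range
  set ρ : ℕ := g.finite_support.toFinset.sup Int.natAbs with hρ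
  have hρs : (ρ : ℝ) ^ s ≤ D := by
    rcases g.finite_support.toFinset.eq_empty_or_nonempty with h0 | h0
    · rw [hρ, h0]
      simpa [Real.zero_rpow hs0.ne'] using hD0
    · obtain ⟨z, hz, hz'⟩ := Finset.exists_mem_eq_sup _ h0 Int.natAbs
      rw [hρ, hz']
      exact hrange z (by simpa using hz)
  have hρD : (ρ : ℝ) ≤ D ^ (1 / s) := by
    have := Real.rpow_le_rpow (by positivity) hρs (by positivity : 0 ≤ 1 / s)
    rwa [← Real.rpow_mul (by positivity), mul_one_div_cancel hs0.ne', Real.rpow_one] at this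
  have hsupp : ∀ x, g.lamp x ≠ 1 → |x| < ((ρ + 1 : ℕ) : ℤ) := by
    intro x hx
    have : x.natAbs ≤ ρ := Finset.le_sup (f := Int.natAbs) (by simpa using hx)
    rw [Int.abs_eq_natAbs]
    omega
  have hDs1 : 1 ≤ D ^ (1 / s) := Real.one_le_rpow hD1 (by positivity)
  have hR : ((ρ + 1 : ℕ) : ℝ) ≤ 2 * D ^ (1 / s) := by
    push_cast
    linarith
  -- the total length of the lamps
  set F := Finset.Ioo (-((ρ + 1 : ℕ) : ℤ)) ((ρ + 1 : ℕ) : ℤ) with hF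
  have hcard : (F.card : ℝ) ≤ 4 * D ^ (1 / s) := by
    have h1 : F.card ≤ 2 * (ρ + 1) := by
      rw [hF, Int.card_Ioo]
      omega
    have h2 : (F.card : ℝ) ≤ 2 * ((ρ + 1 : ℕ) : ℝ) := by exact_mod_cast h1
    linarith
  have hLD : ∑ x ∈ F, (wordLength S (g.lamp x) : ℝ) ≤ 4 * D ^ (1 / β) :=
    sum_le_of_sum_rpow_le (by positivity) hβ0 hs0 hD1 F (fun x => by positivity) hcard (hlamp F)
      (by linarith)
  have hlen : (wordLength T g : ℝ) ≤ 13 * M * D ^ (1 / β) := by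
    refine (hM g (ρ + 1) hsupp).trans ?_
    have h1 : |(g.pos : ℝ)| + 4 * ((ρ + 1 : ℕ) : ℝ) +
        ∑ x ∈ F, (wordLength S (g.lamp x) : ℝ) ≤ 13 * D ^ (1 / β) := by linarith
    calc _ ≤ M * (13 * D ^ (1 / β)) := mul_le_mul_of_nonneg_left h1 hM0.le
      _ = _ := by ring
  have hfin : (wordLength T g : ℝ) ^ β ≤ (13 * M) ^ β * D := by
    have := Real.rpow_le_rpow (by positivity) hlen hβ0.le
    rwa [Real.mul_rpow (by positivity) (by positivity), ← Real.rpow_mul hD0,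
      one_div_mul_cancel hβ0.ne', Real.rpow_one] at this
  rw [inv_mul_le_iff₀ (by positivity)]
  calc _ ≤ (13 * M) ^ β * D := hfin
    _ = _ := by rw [hD]; ring

end Compression

/-! ### The formula for the exponent -/

namespace Compression

open MeasureTheory WreathZ

variable {p : ℝ≥0∞} [Fact (1 ≤ p)]

theorem one_sub_inv_eq (hp : p ≠ ∞) : 1 - p⁻¹ = ENNReal.ofReal (1 - p.toReal⁻¹) := by
  have hp0 : p ≠ 0 := (zero_lt_one.trans_le Fact.out).ne'
  rw [ENNReal.ofReal_sub _ (by positivity), ENNReal.ofReal_one,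
    ENNReal.ofReal_inv_of_pos (ENNReal.toReal_pos hp0 hp), ENNReal.ofReal_toReal hp]

/-- The formula, as a comparison of the sets of admissible exponents of `H` and `H ≀ ℤ`. -/
theorem equivariantLpExponent_wreath (hp2 : p ≤ 2) {H : Type*} [Group H] [Infinite H] {S : Set H}
    (hSfin : S.Finite) (hS : Subgroup.closure S = ⊤) {T : Set (WreathZ H)} (hTfin : T.Finite)
    (hT : Subgroup.closure T = ⊤) :
    equivariantLpExponent p T = min (equivariantLpExponent p S /
      (equivariantLpExponent p S + (1 - p⁻¹))) (equivariantLpExponent p S) := by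
  have hp : p ≠ ∞ := ne_top_of_le_ne_top (by simp) hp2
  set r := p.toReal with hr
  have hr1 : 1 ≤ r := by simpa using ENNReal.toReal_mono hp (Fact.out : 1 ≤ p)
  set u : ℝ := 1 - r⁻¹ with hu
  have hu0 : 0 ≤ u := by
    have : r⁻¹ ≤ 1 := inv_le_one_of_one_le₀ hr1
    linarith
  rw [one_sub_inv_eq hp, ← hr, ← hu]
  have hTeq : equivariantLpExponent p T =
      ⨆ (β : ℝ≥0) (_ : Admissible T (UnitLp p) β), (β : ℝ≥0∞) := equivariantExponent_eq hTfin hT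
  have hSeq : equivariantLpExponent p S =
      ⨆ (β : ℝ≥0) (_ : Admissible S (UnitLp p) β), (β : ℝ≥0∞) := equivariantExponent_eq hSfin hS
  set A := equivariantLpExponent p S with hA
  have hle : ∀ β : ℝ≥0, Admissible S (UnitLp p) β → (β : ℝ≥0∞) ≤ A := fun β hβ => by
    rw [hSeq]
    exact le_iSup₂_of_le β hβ le_rfl
  have hA1 : A ≤ 1 := by
    rw [hSeq]
    refine iSup₂_le fun β hβ => ?_
    exact_mod_cast hβ.le_one hSfin hS
  have hAtop : A ≠ ∞ := ne_top_of_le_ne_top (by simp) hA1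
  set a := A.toReal with ha
  have ha0 : 0 ≤ a := ENNReal.toReal_nonneg
  have hAa : A = ENNReal.ofReal a := (ENNReal.ofReal_toReal hAtop).symm
  have hsum : A + ENNReal.ofReal u = ENNReal.ofReal (a + u) := by
    rw [hAa, ENNReal.ofReal_add ha0 hu0]
  rw [hTeq]
  apply le_antisymm
  · refine iSup₂_le fun β hβ => ?_
    have hβA : (β : ℝ≥0∞) ≤ A := hle β (hβ.of_wreath hS hTfin hT β.2)
    refine le_min ?_ hβA
    rcases eq_or_ne A 0 with h0 | h0
    · rw [h0] at hβA
      exact hβA.trans (zero_le)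
    have hβa : (β : ℝ) ≤ a := by
      have := ENNReal.toReal_mono hAtop hβA
      simpa using this
    have ha1 : a ≤ 1 := by
      have := ENNReal.toReal_mono (by simp) hA1
      simpa using this
    have hapos : 0 < a := ENNReal.toReal_pos h0 hAtop
    have hβ0 : (0 : ℝ) ≤ β := β.2
    have key : (β : ℝ) * (a + u) ≤ a := by
      rcases (Fact.out : 1 ≤ p).eq_or_lt with h1 | h1
      · have : u = 0 := by simp [hu, hr, ← h1]
        rw [this]
        nlinarith
      · refine le_of_forall_pos_le_add fun ε hε => ?_
        have hnot : ¬ Admissible S (UnitLp p) (a + ε) := by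
          intro had
          have h2 := hle ⟨a + ε, by positivity⟩ had
          have h3 : a + ε ≤ a := ENNReal.toReal_mono hAtop h2
          linarith
        have h4 := hβ.mul_le_of_not_admissible h1 hp2 hS hTfin hT hβ0 (by positivity) hnot
        rw [← hr, ← hu] at h4
        nlinarith
    rw [hsum, hAa, ENNReal.le_div_iff_mul_le (Or.inl (by simp; positivity))
      (Or.inl ENNReal.ofReal_ne_top), ← ENNReal.ofReal_coe_nnreal, ← ENNReal.ofReal_mul hβ0]
    exact ENNReal.ofReal_le_ofReal key
  · refine le_of_forall_lt fun b hb => ?_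
    obtain ⟨hb1, hb2⟩ := lt_min_iff.1 hb
    obtain ⟨b', hbb', hb'⟩ := exists_between hb
    obtain ⟨hb1, hb2⟩ := lt_min_iff.1 hb'
    lift b' to ℝ≥0 using (hb2.trans_le le_top).ne
    have hb0 : (0 : ℝ) < b' := by
      have : (0 : ℝ≥0∞) < b' := (zero_le).trans_lt hbb'
      exact_mod_cast this
    have hba : (b' : ℝ) < a := by
      have := (ENNReal.toReal_lt_toReal (by simp) hAtop).2 hb2
      simpa using this
    have hapos : 0 < a := hb0.trans hba
    have hlt : (b' : ℝ) * (a + u) < a := by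
      rw [hsum, hAa, ENNReal.lt_div_iff_mul_lt (Or.inl (by simp; positivity))
        (Or.inl ENNReal.ofReal_ne_top), ← ENNReal.ofReal_coe_nnreal,
        ← ENNReal.ofReal_mul hb0.le] at hb1
      exact (ENNReal.ofReal_lt_ofReal_iff hapos).1 hb1
    have hb1' : (b' : ℝ) < 1 := by
      by_contra! h
      nlinarith
    -- an admissible exponent close enough to the supremum
    have hmax : max (b' : ℝ) (b' * u / (1 - b')) < a := by
      refine max_lt hba ?_
      rw [div_lt_iff₀ (by linarith)]
      linarith
    have hmax' : ENNReal.ofReal (max (b' : ℝ) (b' * u / (1 - b'))) < A := by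
      rw [hAa]
      exact (ENNReal.ofReal_lt_ofReal_iff hapos).2 hmax
    rw [hSeq] at hmax'
    obtain ⟨α, hα⟩ := lt_iSup_iff.1 hmax'
    obtain ⟨hadm, hα⟩ := lt_iSup_iff.1 hα
    rw [← ENNReal.ofReal_coe_nnreal, ENNReal.ofReal_lt_ofReal_iff_of_nonneg
      (le_max_of_le_left hb0.le)] at hα
    obtain ⟨hα1, hα2⟩ := max_lt_iff.1 hα
    rw [div_lt_iff₀ (by linarith)] at hα2
    have hadmT := hadm.wreath hp2 hSfin hS hTfin hT hb0 hα1.le (by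
      rw [← hr, ← hu]
      linarith)
    exact hbb'.trans_le (le_iSup₂_of_le b' hadmT le_rfl)

end Compression

theorem theorem1p6 (p : ENNReal) [Fact (1 ≤ p)] (hp : p ≤ 2)
    (H : Type*) [Group H] [Infinite H] (S : Set H) (hSfin : S.Finite)
    (hS : Subgroup.closure S = ⊤) :
    Group.FG (WreathZ H) ∧
    ∀ T : Set (WreathZ H), T.Finite → Subgroup.closure T = ⊤ →
      Compression.equivariantLpExponent p T =
        min (Compression.equivariantLpExponent p S /
              (Compression.equivariantLpExponent p S + (1 - p⁻¹)))
          (Compression.equivariantLpExponent p S) :=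
  ⟨WreathZ.fg_of_finite hSfin hS, fun _ hTfin hT =>
    Compression.equivariantLpExponent_wreath hp hSfin hS hTfin hT⟩
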